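/- **Proposition (QC-QC description of process boxes).** All Hilbert spaces are finite-dimensional with fixed orthonormal bases (used for Choi vectors and link products). Let $N\ge 1$ agents $A_1,\dots,A_N$ have input spaces $\mathcal H^{A^I_k}$ and nonzero output spaces $\mathcal H^{A^O_k}$, and let $\mathcal H^P,\mathcal H^F$ be the spaces of a global past and a global future. *Process boxes.* The set of positions is $\mathcal T=\{1,2,\dots,M\}$ with $M=2L+2$. Every agent has input positions $2,4,\dots,2L$, output positions $3,5,\dots,2L+1$, and $\mathcal O(t)=t+1$; the global past sends at $t=1$ and the global future receives at $t=M$. At each of its positions an agent's wire carries $|\Omega\rangle\oplus\mathcal H^{A^{I/O}_k}$, with $\Omega$ the vacuum. A process box $\hat\Phi$ is a causal box from the agents' output wires and $P$ to the agents' input wires and $F$: a CPTP map for which there is a causality function $\chi$ on cuts (down-closed subsets of $\mathcal T$) such that, for every cut $\mathcal C$, tracing out the outputs of $\hat\Phi$ outside $\mathcal C$ leaves a CPTP map of the inputs in $\chi(\mathcal C)$ only. (A causality function satisfies $\chi(\mathcal C\cup\mathcal D)=\chi(\mathcal C)\cup\chi(\mathcal D)$, is monotone, satisfies $\chi(\mathcal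 C)\subsetneq\mathcal C$ for bounded $\mathcal C\ne\emptyset$, and for every bounded $\mathcal C$ and $t\in\mathcal C$ there is $n$ with $t\notin\chi^n(\mathcal C)$.) The agents are fully active: for every state of $P$ and all local operations that act independently at each input position $t$ (with output and measurement result at $t+1$), send vacuum to vacuum, and send a message to a message together with a result, each agent receives exactly one message with probability one. A purification of $\hat\Phi$ is an isometry $\bar V$ with an additional output system $E$ such that $\hat\Phi(\rho)=\operatorname{Tr}_E\bar V\rho\bar V^\dagger$; its global future is $F\otimes E$. The effective Choi vector $|\bar V\rangle\rangle$ is the Choi vector of $\bar V$ projected onto the span of the basis states in which, for each agent, all wires are in the vacuum except possibly at one input position $t$ and at the output position $t+1$, and the output is the vacuum if the input is. *QC-QCs.* A QC-QC with past $P'$ and future $F'$ (including all systems sent to the future) is given by memory spaces $\alpha_1,\dots,\alpha_N$ and operators $V^{\to k_1}_{\emptyset,\emptyset}:P'\to A^I_{k_1}\alpha_1$, $V^{\to k_{n+1}}_{\mathcal K_{n-1},k_n}:A^O_{k_n}\alpha_n\to A^I_{k_{n+1}}\alpha_{n+1}$, $V^{\to F}_{\mathcal N\setminus k_N,k_N}:A^O_{k_N}\alpha_N\to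 F'$, for $\mathcal K_{n-1}\subset\mathcal N=\{1,\dots,N\}$ with $|\mathcal K_{n-1}|=n-1$ and distinct $k_n,k_{n+1}\notin\mathcal K_{n-1}$, such that the controlled operations $$\tilde V_1=\sum_{k_1}V^{\to k_1}_{\emptyset,\emptyset}\otimes|\emptyset,k_1\rangle,\quad \tilde V_{n+1}=\sum V^{\to k_{n+1}}_{\mathcal K_{n-1},k_n}\otimes|\mathcal K_{n-1}\cup k_n,k_{n+1}\rangle\langle\mathcal K_{n-1},k_n|,\quad \tilde V_{N+1}=\sum_{k_N}V^{\to F}_{\mathcal N\setminus k_N,k_N}\otimes\langle\mathcal N\setminus k_N,k_N|$$ are isometric on their effective input spaces, i.e. on the span of the states that reach them for some input state and some operators $A_k$ of the agents (applied in a controlled way between the $\tilde V_n$). Its process vector $|w_{\mathcal N,F}\rangle$ is the sum over all orders $(k_1,\dots,k_N)$ of the link products of the Choi vectors of $V^{\to k_1}_{\emptyset,\emptyset},\dots,V^{\to F}_{\mathcal N\setminus k_N,k_N}$. *Operational equivalence.* For $A_k:\mathcal H^{A^I_k}\to\mathcal H^{A^O_k}$ put $\bar A_k=\bigotimes_{t}(A_k\otimes|t+1\rangle\langle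 t|+|\Omega,t+1\rangle\langle\Omega,t|)$, with $t$ running over the input positions. The QC-QC and the purified process box $\bar V$ are operationally equivalent if there are unitaries between their global past spaces and between their global future spaces under which, for all linear operators $A_1,\dots,A_N$, $$(|A_1\rangle\rangle\otimes\dots\otimes|A_N\rangle\rangle)*|w_{\mathcal N,F}\rangle\;\cong\;(|\bar A_1\rangle\rangle\otimes\dots\otimes|\bar A_N\rangle\rangle)*|\bar V\rangle\rangle .$$ *Claim.* Every such process box has a (finite-dimensional) purification, and for every finite-dimensional purification there is a QC-QC that is operationally equivalent to it. -/

import Mathlib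

open Matrix
open scoped Kronecker ComplexConjugate ComplexOrder

noncomputable section

/-! Finite-dimensional Hilbert spaces are given by finite index types of orthonormal bases.
Operators are matrices, with rows indexed by the output space. -/

/-! ### Channels -/

/-- `Φ` is completely positive and trace preserving. -/
structure IsCPTP {m n : Type} [Fintype m] [Fintype n]
    (Φ : Matrix m m ℂ →ₗ[ℂ] Matrix n n ℂ) : Prop where
  completely_positive : ∀ (r : ℕ) (ρ : Matrix (Fin r × m) (Fin r × m) ℂ), ρ.PosSemidef →
    (Matrix.of fun x y : Fin r × n =>
      Φ (Matrix.of fun i j => ρ (x.1, i) (y.1, j)) x.2 y.2).PosSemidef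
  trace_preserving : ∀ ρ, (Φ ρ).trace = ρ.trace

open Classical in
/-- On a tensor product of the spaces `B s`, `s : σ`, trace out all the factors outside `p`. -/
def ptrace {σ : Type} [Fintype σ] {B : σ → Type} [∀ s, Fintype (B s)] (p : σ → Prop)
    (ρ : Matrix (∀ s, B s) (∀ s, B s) ℂ) :
    Matrix (∀ s : {s // p s}, B s) (∀ s : {s // p s}, B s) ℂ :=
  Matrix.of fun a b => ∑ c : (∀ s : {s // ¬ p s}, B s),
    ρ ((Equiv.piEquivPiSubtypeProd p B).symm (a, c))
      ((Equiv.piEquivPiSubtypeProd p B).symm (b, c))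

/-! ### Cuts, causality functions, causal boxes -/

/-- A cut of a set of positions is a down-closed set, i.e. a `LowerSet`. -/
def IsBoundedCut {T : Type} [PartialOrder T] (C : LowerSet T) : Prop := ∃ t, ∀ s ∈ C, s ≤ t

structure IsCausalityFunction {T : Type} [PartialOrder T]
    (χ : LowerSet T → LowerSet T) : Prop where
  union : ∀ C D, χ (C ⊔ D) = χ C ⊔ χ D
  mono : ∀ C D, C ≤ D → χ C ≤ χ D
  strict : ∀ C, IsBoundedCut C → C ≠ ⊥ → χ C < C
  exhaust : ∀ C, IsBoundedCut C → ∀ t ∈ C, ∃ n : ℕ, t ∉ χ^[n] C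

open Classical in
/-- A causal box over a finite totally ordered set `T` of positions. Its input wire consists of
the systems `X s` at the positions `posX s`, its output wire of the systems `Y s` at the positions
`posY s`. Since the whole of `T` is a cut with a greatest position, the consistent family
of maps `Φ^C` is the family of the reductions `part C` of the map `map` that belongs to `T`:
tracing out of its output everything outside `C` leaves a channel `part C` which acts on the inputs
in `χ C` only. -/
structure CausalBox (T : Type) [Fintype T] [LinearOrder T]
    {σX σY : Type} [Fintype σX] [Fintype σY] (posX : σX → T) (posY : σY → T)
    (X : σX → Type) (Y : σY → Type) [∀ s, Fintype (X s)] [∀ s, Fintype (Y s)] where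
  χ : LowerSet T → LowerSet T
  causality : IsCausalityFunction χ
  map : Matrix (∀ s, X s) (∀ s, X s) ℂ →ₗ[ℂ] Matrix (∀ s, Y s) (∀ s, Y s) ℂ
  map_cptp : IsCPTP map
  part : ∀ C : LowerSet T,
    Matrix (∀ s : {s // posX s ∈ χ C}, X s) (∀ s : {s // posX s ∈ χ C}, X s) ℂ →ₗ[ℂ]
      Matrix (∀ s : {s // posY s ∈ C}, Y s) (∀ s : {s // posY s ∈ C}, Y s) ℂ
  part_cptp : ∀ C, IsCPTP (part C)
  ptrace_map : ∀ C ρ,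
    ptrace (fun s => posY s ∈ C) (map ρ) = part C (ptrace (fun s => posX s ∈ χ C) ρ)

/-! ### Positions and wires of a process box of the simplified form

There are `N` agents and `L` rounds. The positions are `1, 2, …, 2L+2`. Every agent can receive at
`2, 4, …, 2L` and sends at `3, 5, …, 2L+1`, the position of the output being that of the input
plus one. The global past sends at `1`, the global future receives at `2L+2`. Round `t : Fin L`
has input position `2t+2` and output position `2t+3`. `none : Option _` is the vacuum. -/

abbrev Position (L : ℕ) : Type := {t : ℕ // 1 ≤ t ∧ t ≤ 2 * L + 2}

instance (L : ℕ) : Fintype (Position L) :=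
  Fintype.ofFinset (p := {t : ℕ | 1 ≤ t ∧ t ≤ 2 * L + 2}) (Finset.Icc 1 (2 * L + 2))
    (fun t => by simp)

/-- The systems on either wire of the box: `none` is the global past, respectively the global
future, and `some (t, k)` is the wire of agent `k` in round `t`. -/
abbrev Slot (N L : ℕ) : Type := Option (Fin L × Fin N)

/-- Positions of the systems entering the box (the outputs of the agents and of the past). -/
def posIn (N L : ℕ) : Slot N L → Position L
  | none => ⟨1, by omega⟩
  | some q => ⟨2 * q.1 + 3, by have := q.1.isLt; omega⟩

/-- Positions of the systems leaving the box (the inputs of the agents and of the future). -/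
def posOut (N L : ℕ) : Slot N L → Position L
  | none => ⟨2 * L + 2, by omega⟩
  | some q => ⟨2 * q.1 + 2, by have := q.1.isLt; omega⟩

/-- With `D` the past (future) space and `A k` the output (input) space of agent `k`:
the agents' systems are extended by the vacuum. -/
def SlotBasis {N : ℕ} (L : ℕ) (A : Fin N → Type) (D : Type) : Slot N L → Type
  | none => D
  | some q => Option (A q.2)

instance SlotBasis.instFintype {N L : ℕ} (A : Fin N → Type) (D : Type)
    [∀ k, Fintype (A k)] [Fintype D] : ∀ s : Slot N L, Fintype (SlotBasis L A D s)
  | none => inferInstanceAs (Fintype D)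
  | some q => inferInstanceAs (Fintype (Option (A q.2)))

instance SlotBasis.instDecidableEq {N L : ℕ} (A : Fin N → Type) (D : Type)
    [∀ k, DecidableEq (A k)] [DecidableEq D] : ∀ s : Slot N L, DecidableEq (SlotBasis L A D s)
  | none => inferInstanceAs (DecidableEq D)
  | some q => inferInstanceAs (DecidableEq (Option (A q.2)))

/-- Basis of the whole input (output) wire of the box. -/
abbrev WireBasis {N : ℕ} (L : ℕ) (A : Fin N → Type) (D : Type) : Type :=
  ∀ s : Slot N L, SlotBasis L A D s

/-- The basis state with `d` in the past (future) and `x k t` on the wire of agent `k` in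
round `t`. -/
def wireState {N L : ℕ} {A : Fin N → Type} {D : Type} (d : D)
    (x : ∀ k, Fin L → Option (A k)) : WireBasis L A D
  | none => d
  | some q => x q.2 q.1

/-! ### Local operations of the agents of a process box, full activity -/

/-- A purified local operation of an agent with input `I`, output `O` and result system `R` (which
carries the measurement result and the purifying environment): one isometry `op t` per round `t`,
from the input at position `2t+2` to the output and the result at position `2t+3`.
The vacuum is sent to the vacuum, and a message is sent to a message and a result. -/
structure LocalOperation (L : ℕ) (I O R : Type) [Fintype I] [Fintype O] [Fintype R]
    [DecidableEq I] [DecidableEq O] [DecidableEq R] where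
  op : Fin L → Matrix (Option O × Option R) (Option I) ℂ
  isometry : ∀ t, (op t)ᴴ * op t = 1
  local_order : ∀ t q, op t q none = if q = (none, none) then 1 else 0
  active : ∀ t i q, (q.1 = none ∨ q.2 = none) → op t q (some i) = 0

section ProcessBoxes

variable {N L : ℕ} {I O : Fin N → Type} {P F : Type}
  [∀ k, Fintype (I k)] [∀ k, Fintype (O k)] [Fintype P] [Fintype F]
  [∀ k, DecidableEq (I k)] [∀ k, DecidableEq (O k)] [DecidableEq P] [DecidableEq F]

/-- The matrix element of the tensor product, over all agents and rounds, of the local operations: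
input `y`, output `x`, result `r`. -/
def jointOp {R : Fin N → Type} [∀ k, Fintype (R k)] [∀ k, DecidableEq (R k)]
    (B : ∀ k, LocalOperation L (I k) (O k) (R k)) (r : ∀ k, Fin L → Option (R k))
    (x : ∀ k, Fin L → Option (O k)) (y : ∀ k, Fin L → Option (I k)) : ℂ :=
  ∏ k, ∏ t, (B k).op t (x k t, r k t) (y k t)

open Classical in
/-- The operator `ρ ⊗ |x⟩⟨x'|` on the input wire of the box, `ρ` being an operator on the
global past. -/
def pastTensor (ρ : Matrix P P ℂ) (x x' : ∀ k, Fin L → Option (O k)) :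
    Matrix (WireBasis L O P) (WireBasis L O P) ℂ :=
  Matrix.of fun a b =>
    if (∀ k t, a (some (t, k)) = x k t) ∧ (∀ k t, b (some (t, k)) = x' k t)
    then ρ (a none) (b none) else 0

/-- The probability that the joint result is `r` when the outputs of the box `Φ` are looped through
the local operations `B` back into the box, for the state `ρ` of the global past. -/
def resultProb (Φ : Matrix (WireBasis L O P) (WireBasis L O P) ℂ →ₗ[ℂ]
      Matrix (WireBasis L I F) (WireBasis L I F) ℂ)
    {R : Fin N → Type} [∀ k, Fintype (R k)] [∀ k, DecidableEq (R k)]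
    (B : ∀ k, LocalOperation L (I k) (O k) (R k)) (ρ : Matrix P P ℂ)
    (r : ∀ k, Fin L → Option (R k)) : ℂ :=
  ∑ x : (∀ k, Fin L → Option (O k)), ∑ x' : (∀ k, Fin L → Option (O k)),
    ∑ y : (∀ k, Fin L → Option (I k)), ∑ y' : (∀ k, Fin L → Option (I k)),
      jointOp B r x y * conj (jointOp B r x' y') *
        ∑ f : F, Φ (pastTensor ρ x x') (wireState f y) (wireState f y')

/-- Full activity: whatever the local operations and the state of the global past, with
certainty every agent receives exactly one message. (An agent obtains a result in a round if and
only if it receives a message in it.) -/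
def FullyActive (Φ : Matrix (WireBasis L O P) (WireBasis L O P) ℂ →ₗ[ℂ]
    Matrix (WireBasis L I F) (WireBasis L I F) ℂ) : Prop :=
  ∀ (R : Fin N → Type) [∀ k, Fintype (R k)] [∀ k, DecidableEq (R k)]
    (B : ∀ k, LocalOperation L (I k) (O k) (R k)) (ρ : Matrix P P ℂ),
    ρ.PosSemidef → ρ.trace = 1 →
    ∀ r : (∀ k, Fin L → Option (R k)), (¬ ∀ k, ∃! t, r k t ≠ none) → resultProb Φ B ρ r = 0

end ProcessBoxes

/-- A process box of the simplified form with fully active agents. -/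
structure ProcessBox (N L : ℕ) (I O : Fin N → Type) (P F : Type)
    [∀ k, Fintype (I k)] [∀ k, Fintype (O k)] [Fintype P] [Fintype F]
    [∀ k, DecidableEq (I k)] [∀ k, DecidableEq (O k)] [DecidableEq P] [DecidableEq F]
    extends CausalBox (Position L) (posIn N L) (posOut N L)
      (SlotBasis L O P) (SlotBasis L I F) where
  fullyActive : FullyActive map

section ProcessBoxes

variable {N L : ℕ} {I O : Fin N → Type} {P F : Type}
  [∀ k, Fintype (I k)] [∀ k, Fintype (O k)] [Fintype P] [Fintype F]
  [∀ k, DecidableEq (I k)] [∀ k, DecidableEq (O k)] [DecidableEq P] [DecidableEq F]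

/-- `V` is an isometry, with purifying system `E`, that induces the process box `Φ`. -/
structure ProcessBox.IsPurification (Φ : ProcessBox N L I O P F) {E : Type} [Fintype E]
    (V : Matrix (WireBasis L I F × E) (WireBasis L O P) ℂ) : Prop where
  isometry : Vᴴ * V = 1
  dilates : ∀ ρ y y', Φ.map ρ y y' = ∑ e, (V * ρ * Vᴴ) (y, e) (y', e)

/-- The basis states of one agent (input and output, round by round) spanning the effective space:
vacuum except for at most one input and the corresponding output, and no output without input. -/
def IsEffective {I O : Type} (h : Fin L → Option I × Option O) : Prop :=
  ∃ t, (∀ s, s ≠ t → h s = (none, none)) ∧ ((h t).1 = none → (h t).2 = none)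

open Classical in
/-- The effective Choi vector of `V`, a vector on the agents' wires, the global past and the global
future, the latter including the purifying system. -/
def effectiveChoi {E : Type} (V : Matrix (WireBasis L I F × E) (WireBasis L O P) ℂ) :
    (∀ k, Fin L → Option (I k) × Option (O k)) × (P × (F × E)) → ℂ :=
  fun q =>
    if ∀ k, IsEffective (q.1 k) then
      V (wireState q.2.2.1 (fun k t => (q.1 k t).1), q.2.2.2)
        (wireState q.2.1 (fun k t => (q.1 k t).2))
    else 0

/-- `A ⊕ |Ω⟩⟨Ω|`. -/
def withVacuum {I O : Type} (A : Matrix O I ℂ) : Matrix (Option O) (Option I) ℂ :=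
  Matrix.of fun
    | some o, some i => A o i
    | none, none => 1
    | _, _ => 0

/-- The local operation of a process box that is equivalent to `A`: the tensor product over all
rounds of `A ⊕ |Ω⟩⟨Ω|`. -/
def equivalentOp {I O : Type} (L : ℕ) (A : Matrix O I ℂ) :
    Matrix (Fin L → Option O) (Fin L → Option I) ℂ :=
  Matrix.of fun x y => ∏ t, withVacuum A (x t) (y t)

/-- The link product of a vector on the system `Y` with a vector on the systems `Y` and `Z`. -/
def link {Y Z : Type} [Fintype Y] (a : Y → ℂ) (b : Y × Z → ℂ) : Z → ℂ :=
  fun z => ∑ y, a y * b (y, z)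

/-- The tensor product of the Choi vectors of the operators `A k`. -/
def choiTensor (A : ∀ k, Matrix (O k) (I k) ℂ) : (∀ k, I k × O k) → ℂ :=
  fun g => ∏ k, A k (g k).2 (g k).1

/-- The tensor product of the Choi vectors of the operations of a process box that are equivalent
to the operators `A k`. -/
def equivalentChoiTensor (L : ℕ) (A : ∀ k, Matrix (O k) (I k) ℂ) :
    (∀ k, Fin L → Option (I k) × Option (O k)) → ℂ :=
  fun h => ∏ k, equivalentOp L (A k) (fun t => (h k t).2) (fun t => (h k t).1)

end ProcessBoxes

/-! ### Quantum circuits with quantum control of causal order -/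

/-- The internal operations of a circuit for `N` agents with memory `α n` in step `n`. `step n K k k'`
is the operator that is applied when the agents in `K` have acted before, agent `k` has acted
in step `n`, and agent `k'` is to act in step `n + 1`; only `K.card + 1 = n`, `k ∉ K`,
`k' ∉ insert k K` matter. `F` includes all systems sent to the global future. -/
structure ControlledCircuit (N : ℕ) (I O : Fin N → Type) (P F : Type) where
  α : ℕ → Type
  [fintypeα : ∀ n, Fintype (α n)]
  [decidableEqα : ∀ n, DecidableEq (α n)]
  first : ∀ k, Matrix (I k × α 1) P ℂ
  step : ∀ (n : ℕ) (_ : Finset (Fin N)) (k k' : Fin N),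
    Matrix (I k' × α (n + 1)) (O k × α n) ℂ
  last : ∀ k, Matrix F (O k × α N) ℂ

attribute [instance] ControlledCircuit.fintypeα ControlledCircuit.decidableEqα

/-- The basis states `|K, k⟩` of the control system in step `n`. -/
abbrev Control (N n : ℕ) : Type :=
  {c : Finset (Fin N) × Fin N // c.1.card + 1 = n ∧ c.2 ∉ c.1}

namespace ControlledCircuit

variable {N : ℕ} {I O : Fin N → Type} {P F : Type}
  [∀ k, Fintype (I k)] [∀ k, Fintype (O k)] [Fintype P] [Fintype F]
  [∀ k, DecidableEq (I k)] [∀ k, DecidableEq (O k)] [DecidableEq P] [DecidableEq F]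
  (Q : ControlledCircuit N I O P F)

/-- Control, input of the agent that acts in step `n`, and memory. -/
abbrev Before (n : ℕ) : Type := Σ c : Control N n, I c.1.2 × Q.α n

/-- Control, output of the agent that acts in step `n`, and memory. -/
abbrev After (n : ℕ) : Type := Σ c : Control N n, O c.1.2 × Q.α n

/-- The first controlled internal operation. -/
def VFirst : Matrix (Q.Before 1) P ℂ := Matrix.of fun y p => Q.first y.1.1.2 y.2 p

/-- The controlled internal operation between the steps `n` and `n + 1`. -/
def VStep (n : ℕ) : Matrix (Q.Before (n + 1)) (Q.After n) ℂ :=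
  Matrix.of fun y x =>
    if y.1.1.1 = insert x.1.1.2 x.1.1.1 then
      Q.step n x.1.1.1 x.1.1.2 y.1.1.2 y.2 x.2
    else 0

/-- The last controlled internal operation. -/
def VLast : Matrix F (Q.After N) ℂ := Matrix.of fun f x => Q.last x.1.1.2 f x.2

/-- The controlled application of the local operators in step `n`. -/
def agents (A : ∀ k, Matrix (O k) (I k) ℂ) (n : ℕ) : Matrix (Q.After n) (Q.Before n) ℂ :=
  Matrix.blockDiagonal' fun c : Control N n => A c.1.2 ⊗ₖ (1 : Matrix (Q.α n) (Q.α n) ℂ)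

/-- The circuit with local operators `A` up to the moment before the agents act in step `n`. -/
def upTo (A : ∀ k, Matrix (O k) (I k) ℂ) : (n : ℕ) → Matrix (Q.Before n) P ℂ
  | 0 => 0
  | 1 => Q.VFirst
  | n + 2 => Q.VStep (n + 1) * (Q.agents A (n + 1) * upTo A (n + 1))

/-- The effective input space of the internal operation after step `n`: the span of all
states that arrive there for some input state and some local operators. -/
def effectiveSpace (n : ℕ) : Submodule ℂ (Q.After n → ℂ) :=
  Submodule.span ℂ {u | ∃ (A : ∀ k, Matrix (O k) (I k) ℂ) (ψ : P → ℂ),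
    u = (Q.agents A n * Q.upTo A n) *ᵥ ψ}

/-- The circuit is a QC-QC: the internal operations are isometries, on the states that they can
receive. -/
structure IsQCQC : Prop where
  first_isometry : Q.VFirstᴴ * Q.VFirst = 1
  step_isometry : ∀ n, 1 ≤ n → n < N → ∀ u ∈ Q.effectiveSpace n, ∀ v ∈ Q.effectiveSpace n,
    star (Q.VStep n *ᵥ u) ⬝ᵥ (Q.VStep n *ᵥ v) = star u ⬝ᵥ v
  last_isometry : ∀ u ∈ Q.effectiveSpace N, ∀ v ∈ Q.effectiveSpace N,
    star (Q.VLast *ᵥ u) ⬝ᵥ (Q.VLast *ᵥ v) = star u ⬝ᵥ v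

/-- The coordinates of the vector `|w_(K, k)⟩`, where `K` has `n - 1` elements and `k ∉ K`:
the sum over all orders `(k₁, …, k_(n-1))` of `K` of the link product of the Choi vectors of the
internal operations applied up to the arrival at agent `k` in step `n`. -/
def partialVector : (n : ℕ) → Finset (Fin N) → Fin N →
    P → (∀ k, I k × O k) → Q.α n → ℂ
  | 0, _, _ => fun _ _ _ => 0
  | 1, _, k => fun p g a => Q.first k ((g k).1, a) p
  | n + 2, K, k => fun p g a => ∑ l ∈ K, ∑ b,
      Q.step (n + 1) (K.erase l) l k ((g k).1, a) ((g l).2, b) *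
        partialVector (n + 1) (K.erase l) l p g b

/-- The process vector `|w_(𝒩, F)⟩`. -/
def processVector : (∀ k, I k × O k) × (P × F) → ℂ :=
  fun q => ∑ k, ∑ b, Q.last k q.2.2 ((q.1 k).2, b) *
    Q.partialVector N (Finset.univ.erase k) k q.2.1 q.1 b

end ControlledCircuit

/-! ### Operational equivalence -/

/-- The circuit `Q` and the process box with purification `V` act in the same way on all equivalent
local operations, up to fixed unitaries `UP` and `UF` between their global past and global future
spaces. -/
def OperationallyEquivalent {N L : ℕ} {I O : Fin N → Type} {P F E P' F' : Type}
    [∀ k, Fintype (I k)] [∀ k, Fintype (O k)] [Fintype P] [Fintype F] [Fintype E]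
    [Fintype P'] [Fintype F'] [DecidableEq P] [DecidableEq F] [DecidableEq E]
    [DecidableEq P'] [DecidableEq F']
    (Q : ControlledCircuit N I O P' F')
    (V : Matrix (WireBasis L I F × E) (WireBasis L O P) ℂ) : Prop :=
  ∃ (UP : Matrix P' P ℂ) (UF : Matrix F' (F × E) ℂ),
    (UPᴴ * UP = 1 ∧ UP * UPᴴ = 1) ∧ (UFᴴ * UF = 1 ∧ UF * UFᴴ = 1) ∧
    ∀ A : (∀ k, Matrix (O k) (I k) ℂ),
      link (choiTensor A) Q.processVector =
        (UP ⊗ₖ UF) *ᵥ link (equivalentChoiTensor L A) (effectiveChoi V)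

end

/-! The purification is a Stinespring dilation. For the second claim, a QC-QC is built whose states
are partial sums of amplitudes of `V`; its internal operations are not written down but obtained
from equalities of Gram matrices.

By linearity the agents may be taken to apply matrix units `|o⟩⟨i|`, given by one pair `g k = (i,
o)` per agent. A history `τ` records in which round each agent that has acted received its message.
The control system knows only the set `S` of these agents and the last of them, so the amplitudes of
all histories with the same `S` are added. The memory carries the current round, the answers given
in it, the messages not yet delivered and the state of the future. Messages of a round do not depend
on answers of that round, so agents addressed in the same round can be served one by one, in the
order of their indices, and their answers are withheld from the box until the round is over. This
yields the vector `sent` just after the agents in `S` have acted and the vector `received` just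
before the next one acts.

The heart is `gram_sent_add`. The products of two history sums are added up over all memory states
in which the answers of the current round precede, in agent order, its remaining messages. Memory
states with an answer contribute the Gram matrix of `sent`, those without one contribute
`prefixGram` at the start of the round. Memory states with a message left in the round contribute
the Gram matrix of `received` (full activity excludes a second message to an agent, by
`IsCausalAmplitude.eq_zero`), those without one contribute `prefixGram` at the next round, which is
where causality enters (`prefixGram_succ`). Comparing the two splittings, the `prefixGram` terms
telescope to boundary terms at rounds `0` and `L`. Both vanish if `S` is neither empty nor
everything. For `S = ∅` the first is the identity, as `V` is an isometry; for `S` full the second is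
the Gram matrix of the final amplitudes.

Families with equal Gram matrices are related by a matrix that is isometric on their span
(`exists_matrix_mulVec_eq`); these matrices are the internal operations. The process vector is then
`finalSum`, which is exactly what the equivalent local operations extract from the effective Choi
vector (`link_equivalentChoiTensor`), so both unitaries can be the identity. -/

noncomputable section

/-! ### Stinespring dilation -/

open scoped MatrixOrder in
theorem Matrix.PosSemidef.exists_eq_conjTranspose_mul_self {m : Type*} [Fintype m]
    {A : Matrix m m ℂ} (hA : A.PosSemidef) : ∃ B : Matrix m m ℂ, A = Bᴴ * B := by
  classical
  exact CStarAlgebra.nonneg_iff_eq_star_mul_self.mp hA.nonneg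

theorem mul_mul_conjTranspose_apply {m n : Type*} [Fintype m] (V : Matrix n m ℂ)
    (ρ : Matrix m m ℂ) (a b : n) :
    (V * ρ * Vᴴ) a b = ∑ i, ∑ j, ρ i j * (V a i * conj (V b j)) := by
  simp only [mul_apply, conjTranspose_apply, Finset.sum_mul]
  rw [Finset.sum_comm]
  exact Finset.sum_congr rfl fun i _ => Finset.sum_congr rfl fun j _ => by
    rw [starRingEnd_apply]; ring

/-- The Choi matrix of `Φ`, its value on half of the unnormalised maximally entangled vector `w`,
factors as `Bᴴ * B`; the conjugated rows of `B` are Kraus operators. Trace preservation makes their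
stack an isometry. -/
theorem IsCPTP.exists_dilation {m n : Type} {_ : Fintype m} {_ : Fintype n}
    {Φ : Matrix m m ℂ →ₗ[ℂ] Matrix n n ℂ} (hΦ : IsCPTP Φ) [DecidableEq m] :
    ∃ (E : Type) (_ : Fintype E) (V : Matrix (n × E) m ℂ), Vᴴ * V = 1 ∧
      ∀ ρ y y', Φ ρ y y' = ∑ e, (V * ρ * Vᴴ) (y, e) (y', e) := by
  classical
  let ε : m ≃ Fin (Fintype.card m) := Fintype.equivFin m
  let w : Fin (Fintype.card m) × m → ℂ := fun x => if ε x.2 = x.1 then 1 else 0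
  have hC := hΦ.completely_positive _ (vecMulVec w (star w)) (posSemidef_vecMulVec_self_star w)
  obtain ⟨B, hB⟩ := hC.exists_eq_conjTranspose_mul_self
  let V : Matrix (n × (Fin (Fintype.card m) × n)) m ℂ :=
    Matrix.of fun q i => conj (B q.2 (ε i, q.1))
  have hsingle : ∀ i j y y', Φ (single i j 1) y y' = ∑ e, V (y, e) i * conj (V (y', e) j) := by
    intro i j y y'
    have h := congrFun (congrFun hB (ε i, y)) (ε j, y')
    have h1 : (Matrix.of fun i' j' => vecMulVec w (star w) (ε i, i') (ε j, j')) = single i j 1 := by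
      ext i' j'
      by_cases h1 : i = i' <;> by_cases h2 : j = j' <;>
        simp [w, vecMulVec_apply, h1, h2, eq_comm]
    simp only [of_apply] at h
    rw [h1] at h
    rw [h]
    simp [V, mul_apply]
  refine ⟨_, inferInstance, V, ?_, ?_⟩
  · ext j i
    have h := hΦ.trace_preserving (single i j 1)
    simp only [trace, diag_apply, hsingle] at h
    rw [mul_apply, Fintype.sum_prod_type]
    simp only [conjTranspose_apply]
    have : ∑ k, (single i j (1 : ℂ)) k k = (1 : Matrix m m ℂ) j i := by
      simp only [single_apply, one_apply]
      by_cases hij : i = j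
      · subst hij; simp
      · simp only [Ne.symm hij, if_false]
        exact Finset.sum_eq_zero fun k _ => if_neg fun hk => hij (hk.1.trans hk.2.symm)
    rw [← this, ← h]
    exact Finset.sum_congr rfl fun y _ => Finset.sum_congr rfl fun e _ => mul_comm _ _
  · intro ρ y y'
    have h : Φ ρ y y' = ∑ i, ∑ j, ρ i j * Φ (single i j 1) y y' := by
      conv_lhs => rw [matrix_eq_sum_single ρ]
      simp only [map_sum, Matrix.sum_apply]
      refine Finset.sum_congr rfl fun i _ => Finset.sum_congr rfl fun j _ => ?_
      rw [← mul_one (ρ i j), ← smul_eq_mul, ← smul_single, map_smul]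
      simp
    rw [h]
    simp only [hsingle, mul_mul_conjTranspose_apply, Finset.mul_sum]
    conv_rhs => rw [Finset.sum_comm]
    exact Finset.sum_congr rfl fun i _ => Finset.sum_comm

/-! ### Vectors with equal Gram matrices -/

/-- The Gram matrix determines the norm of every linear combination, so each linear relation among
the `u j` also holds among the `v j`. Hence `u j ↦ v j` is well defined on the span and extends
linearly. -/
theorem exists_matrix_mulVec_eq {J X Y : Type*} [Fintype X] [Fintype Y] [DecidableEq X]
    (u : J → X → ℂ) (v : J → Y → ℂ)
    (h : ∀ j j', star (u j) ⬝ᵥ u j' = star (v j) ⬝ᵥ v j') :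
    ∃ M : Matrix Y X ℂ, ∀ j, M *ᵥ u j = v j := by
  classical
  have gram : ∀ c : J →₀ ℂ, star (Finsupp.linearCombination ℂ u c) ⬝ᵥ
      Finsupp.linearCombination ℂ u c = star (Finsupp.linearCombination ℂ v c) ⬝ᵥ
      Finsupp.linearCombination ℂ v c := by
    intro c
    simp only [Finsupp.linearCombination_apply, Finsupp.sum, star_sum, sum_dotProduct,
      dotProduct_sum, star_smul, smul_dotProduct, dotProduct_smul, h]
  have hker : ∀ c : J →₀ ℂ, Finsupp.linearCombination ℂ u c = 0 →
      Finsupp.linearCombination ℂ v c = 0 := by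
    intro c hc
    have := gram c
    rw [hc] at this
    rw [star_zero, zero_dotProduct] at this
    exact dotProduct_star_self_eq_zero.1 this.symm
  -- `s` chooses coefficients for each vector of the span; by `hker` the choice does not affect the
  -- image.
  obtain ⟨s, hs⟩ := (Finsupp.linearCombination ℂ u).rangeRestrict.exists_rightInverse_of_surjective
    (LinearMap.range_rangeRestrict _)
  obtain ⟨f, hf⟩ := LinearMap.exists_extend ((Finsupp.linearCombination ℂ v).comp s)
  refine ⟨LinearMap.toMatrix' f, fun j => ?_⟩
  rw [← toLin'_apply, toLin'_toMatrix']
  have h1 : u j = Finsupp.linearCombination ℂ u (Finsupp.single j 1) := by simp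
  set x := (Finsupp.linearCombination ℂ u).rangeRestrict (Finsupp.single j 1) with hx
  have h2 : f (x : X → ℂ) = Finsupp.linearCombination ℂ v (s x) := LinearMap.congr_fun hf x
  have h3 : (x : X → ℂ) = u j := by simp [hx]
  rw [← h3, h2]
  have h4 : Finsupp.linearCombination ℂ u (s x - Finsupp.single j 1) = 0 := by
    have : Finsupp.linearCombination ℂ u (s x) = x :=
      congrArg Subtype.val (LinearMap.congr_fun hs x)
    rw [map_sub, this, h3]; simp
  have h5 := hker _ h4
  rw [map_sub, sub_eq_zero] at h5
  simpa using h5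

/-- A matrix that preserves the Gram matrix of a family is isometric on its span. -/
theorem dotProduct_mulVec_of_mem_span {X Y : Type*} [Fintype X] [Fintype Y]
    (M : Matrix Y X ℂ) (s : Set (X → ℂ))
    (h : ∀ u ∈ s, ∀ v ∈ s, star (M *ᵥ u) ⬝ᵥ (M *ᵥ v) = star u ⬝ᵥ v)
    {u v : X → ℂ} (hu : u ∈ Submodule.span ℂ s) (hv : v ∈ Submodule.span ℂ s) :
    star (M *ᵥ u) ⬝ᵥ (M *ᵥ v) = star u ⬝ᵥ v := by
  induction hu, hv using Submodule.span_induction₂ with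
  | mem_mem x y hx hy => exact h x hx y hy
  | zero_left => simp
  | zero_right => simp
  | add_left x y z _ _ _ h1 h2 => simp [mulVec_add, add_dotProduct, h1, h2]
  | add_right x y z _ _ _ h1 h2 => simp [mulVec_add, dotProduct_add, h1, h2]
  | smul_left r x y _ _ h1 => simp [mulVec_smul, smul_dotProduct, h1]
  | smul_right r x y _ _ h1 => simp [mulVec_smul, dotProduct_smul, h1]

/-! ### Message patterns -/

/-- The contents of all the agents' wires, round by round. -/
abbrev Messages {N : ℕ} (L : ℕ) (A : Fin N → Type) : Type := ∀ k, Fin L → Option (A k)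

namespace Messages

variable {N L : ℕ} {A B : Fin N → Type}

/-- No message anywhere. -/
def vacuum : Messages L A := fun _ _ => none

/-- No message before round `t`. -/
def VacantBefore (t : ℕ) (c : Messages L A) : Prop := ∀ k (r : Fin L), r.val < t → c k r = none

def AgreeBefore (t : ℕ) (x x' : Messages L A) : Prop := ∀ k (r : Fin L), r.val < t → x k r = x' k r

def AgreeFrom (t : ℕ) (x x' : Messages L A) : Prop := ∀ k (r : Fin L), t ≤ r.val → x k r = x' k r

/-- The messages of `y` in the rounds before `t`, those of `c` afterwards. -/
def splice (t : ℕ) (y c : Messages L A) : Messages L A :=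
  fun k r => if r.val < t then y k r else c k r

/-- The messages of `y`, and those of `c` wherever `y` has none. -/
def overlay (y c : Messages L A) : Messages L A := fun k r => (y k r).or (c k r)

/-- `x` answers precisely the messages of `y` in the rounds before `t`. -/
def MatchedBefore (t : ℕ) (x : Messages L A) (y : Messages L B) : Prop :=
  ∀ k (r : Fin L), r.val < t → (x k r = none ↔ y k r = none)

/-- Every agent receives exactly one message. -/
def ExactlyOnce (y : Messages L A) : Prop := ∀ k, ∃! r, y k r ≠ none

/-- The messages `g` at the rounds prescribed by `τ`. -/
def ofHistory (τ : Fin N → Option (Fin L)) (g : ∀ k, A k) : Messages L A :=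
  fun k r => if τ k = some r then some (g k) else none

/-- The pattern `c` with the message `i` to agent `k` in round `t` added. -/
def put (c : Messages L A) (k : Fin N) (t : Fin L) (i : A k) : Messages L A :=
  Function.update c k (Function.update (c k) t (some i))

@[simp] theorem put_self (c : Messages L A) (k : Fin N) (t : Fin L) (i : A k) :
    put c k t i k t = some i := by simp [put]

theorem put_of_ne (c : Messages L A) {k j : Fin N} {t r : Fin L} (i : A k)
    (h : j ≠ k ∨ r ≠ t) : put c k t i j r = c j r := by
  by_cases hj : j = k
  · subst hj
    have hr : r ≠ t := h.resolve_left (by simp)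
    simp [put, hr]
  · simp [put, hj]

theorem ofHistory_eq_none {τ : Fin N → Option (Fin L)} {g : ∀ k, A k} {k : Fin N} {r : Fin L} :
    ofHistory τ g k r = none ↔ τ k ≠ some r := by
  simp [ofHistory]

theorem ofHistory_of_eq {τ : Fin N → Option (Fin L)} {g : ∀ k, A k} {k : Fin N} {r : Fin L}
    (h : τ k = some r) : ofHistory τ g k r = some (g k) := if_pos h

theorem ofHistory_of_ne {τ : Fin N → Option (Fin L)} {g : ∀ k, A k} {k : Fin N} {r : Fin L}
    (h : τ k ≠ some r) : ofHistory τ g k r = none := if_neg h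

end Messages

open Messages

/-! ### Causal amplitudes -/

open Classical in
/-- What is used of the matrix elements `amp p x z y` of a purified process box with fully active
agents: `p` and `z` are states of the global past and the global future, `x` is the pattern of
messages from the agents and `y` that of messages to the agents. -/
structure IsCausalAmplitude {N L : ℕ} {I O : Fin N → Type} {P Z : Type}
    [∀ k, Fintype (I k)] [Fintype Z]
    (amp : P → Messages L O → Z → Messages L I → ℂ) : Prop where
  norm : ∀ p p', ∑ y, ∑ z, conj (amp p vacuum z y) * amp p' vacuum z y = if p = p' then 1 else 0
  -- The sums over `c` and `z` are matrix elements of the output reduced to the rounds up to `t`.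
  -- Agents' answers from round `t` on lie outside its causal past: they are traced out, so only
  -- their agreement matters.
  causal_zero : ∀ t < L, ∀ p p' x x' y y', ¬ AgreeFrom t x x' →
    ∑ c with VacantBefore (t + 1) c, ∑ z,
      conj (amp p x z (splice (t + 1) y c)) * amp p' x' z (splice (t + 1) y' c) = 0
  causal_congr : ∀ t < L, ∀ p p' x x' w w' y y', AgreeFrom t x x' → AgreeFrom t w w' →
    AgreeBefore t x w → AgreeBefore t x' w' →
    ∑ c with VacantBefore (t + 1) c, ∑ z,
      conj (amp p x z (splice (t + 1) y c)) * amp p' x' z (splice (t + 1) y' c) =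
    ∑ c with VacantBefore (t + 1) c, ∑ z,
      conj (amp p w z (splice (t + 1) y c)) * amp p' w' z (splice (t + 1) y' c)
  active : ∀ p x z y, MatchedBefore L x y → ¬ ExactlyOnce y → amp p x z y = 0

namespace IsCausalAmplitude

variable {N L : ℕ} {I O : Fin N → Type} {P Z : Type}
    [∀ k, Fintype (I k)] [Fintype Z] {amp : P → Messages L O → Z → Messages L I → ℂ}

/-- A history that can no longer be completed to one in which every agent receives exactly one
message has amplitude zero. -/
theorem eq_zero [∀ k, Nonempty (O k)] (h : IsCausalAmplitude amp) (t : ℕ) (ht : t < L) (p : P)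
    (x : Messages L O) (z : Z) (y : Messages L I) (hm : MatchedBefore t x y)
    (hy : ∀ y', AgreeBefore (t + 1) y y' → ¬ ExactlyOnce y') : amp p x z y = 0 := by
  classical
  obtain ⟨s, hs⟩ : ∃ s, L = t + 1 + s := ⟨L - (t + 1), by omega⟩
  induction s generalizing t x z y with
  | zero | succ s ih =>
    -- From round `t` on, `w` answers exactly the messages of `y`. It is therefore matched one round
    -- further than `x`.
    let w : Messages L O := fun k r => if r.val < t then x k r else
      if y k r = none then none else some (Classical.arbitrary _)
    have hmw : MatchedBefore (t + 1) w y := by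
      intro k r hr
      by_cases hrt : r.val < t
      · simpa [w, hrt] using hm k r hrt
      · simp [w, hrt]
    have hzero : ∀ c : Messages L I, ∀ z, VacantBefore (t + 1) c →
        amp p w z (splice (t + 1) y c) = 0 := by
      intro c z _
      have hms : MatchedBefore (t + 1) w (splice (t + 1) y c) := by
        intro k r hr
        simpa [splice, hr] using hmw k r hr
      have hag : AgreeBefore (t + 1) y (splice (t + 1) y c) := by
        intro k r hr
        simp [splice, hr]
      -- If rounds remain, the induction hypothesis applies at `t + 1`; if `t` is the last round,
      -- the pattern is matched everywhere and `active` applies.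
      first
        | exact ih (t + 1) (by omega) w z _ hms (fun y' hy' => hy y' fun k r hr =>
            (hag k r hr).trans (hy' k r (by omega))) (by omega)
        | exact h.active p w z _ (fun k r _ => hms k r (by omega)) (hy _ hag)
    -- Replacing `x` by `w` leaves the reduced output unchanged. The sum of squared moduli for `x`
    -- thus vanishes, and the wanted amplitude is one of its terms.
    have key := h.causal_congr t ht p p x x w w y y (fun _ _ _ => rfl) (fun _ _ _ => rfl)
      (fun k r hr => by simp [w, hr]) (fun k r hr => by simp [w, hr])
    rw [Finset.sum_eq_zero (s := Finset.univ.filter _) (f := fun c => ∑ z,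
      conj (amp p w z (splice (t + 1) y c)) * amp p w z (splice (t + 1) y c))] at key
    · let c : Messages L I := fun k r => if r.val < t + 1 then none else y k r
      have hc : VacantBefore (t + 1) c := fun k r hr => if_pos hr
      have hyc : splice (t + 1) y c = y := by
        funext k r
        by_cases hr : r.val < t + 1 <;> simp only [splice, c, hr, if_true, if_false]
      have hnn : ∀ a : ℂ, 0 ≤ conj a * a := fun a => by
        rw [mul_comm]; exact mul_star_self_nonneg a
      rw [Finset.sum_eq_zero_iff_of_nonneg fun c _ => Finset.sum_nonneg fun z _ => hnn _] at key
      have key2 := key c (by simpa using hc)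
      rw [Finset.sum_eq_zero_iff_of_nonneg fun z _ => hnn _] at key2
      have key3 := key2 z (Finset.mem_univ z)
      rw [hyc] at key3
      simpa using key3
    · intro c hc
      exact Finset.sum_eq_zero fun z _ => by
        rw [hzero c z (by simpa using hc), mul_zero]

end IsCausalAmplitude

/-! ### Sums over histories -/

section HistorySums

variable {N L : ℕ} {I O : Fin N → Type} {P Z : Type}

/-- The memory of the circuit: the current round, the answers already given in this round, the
messages still to be delivered, and the state of the global future. -/
abbrev Memory (L : ℕ) (I O : Fin N → Type) (Z : Type) : Type :=
  Fin L × (∀ k, Option (O k)) × Messages L I × Z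

open Classical in
/-- The histories in which the agents in `S` have received their message, before round `t`. -/
def histories (L : ℕ) (S : Finset (Fin N)) (t : ℕ) : Finset (Fin N → Option (Fin L)) :=
  {τ | (∀ k, τ k ≠ none ↔ k ∈ S) ∧ ∀ k r, τ k = some r → r.val < t}

theorem mem_histories {S : Finset (Fin N)} {t : ℕ} {τ : Fin N → Option (Fin L)} :
    τ ∈ histories L S t ↔ (∀ k, τ k ≠ none ↔ k ∈ S) ∧ ∀ k r, τ k = some r → r.val < t := by
  simp [histories]

/-- The messages to the agents in the history `τ`. -/
abbrev inputs (τ : Fin N → Option (Fin L)) (g : ∀ k, I k × O k) : Messages L I :=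
  ofHistory τ fun k => (g k).1

/-- The messages from the agents in the history `τ`. -/
abbrev outputs (τ : Fin N → Option (Fin L)) (g : ∀ k, I k × O k) : Messages L O :=
  ofHistory τ fun k => (g k).2

variable (amp : P → Messages L O → Z → Messages L I → ℂ)

open Classical in
/-- The total amplitude of the histories in which the agents in `S` have received their message up
to the round in the memory, and of the further data in the memory. -/
def historySum (S : Finset (Fin N)) (g : ∀ k, I k × O k) (p : P) (m : Memory L I O Z) : ℂ :=
  ∑ τ ∈ histories L S (m.1 + 1), if (fun k => outputs τ g k m.1) = m.2.1 then
    amp p (splice m.1 (outputs τ g) vacuum) m.2.2.2 (overlay (inputs τ g) m.2.2.1) else 0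

/-- The total amplitude of the histories in which the agents in `S` have received their message
before round `t`, and of the further messages `c`. -/
def prefixSum (S : Finset (Fin N)) (g : ∀ k, I k × O k) (p : P) (t : ℕ) (c : Messages L I)
    (z : Z) : ℂ :=
  ∑ τ ∈ histories L S t, amp p (outputs τ g) z (overlay (inputs τ g) c)

open Classical in
-- The Gram matrix of the states at the start of round `t`, when the answers of all earlier rounds
-- have been fed to the box. These are the terms that telescope in `gram_sent_add`.
def prefixGram [∀ k, Fintype (I k)] [Fintype Z] (S : Finset (Fin N)) (g g' : ∀ k, I k × O k)
    (p p' : P) (t : ℕ) : ℂ :=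
  ∑ c with VacantBefore t c, ∑ z,
    conj (prefixSum amp S g p t c z) * prefixSum amp S g' p' t c z

theorem sum_conj_sum_mul_sum {κ ι ζ : Type*} [Fintype ζ] (s : Finset κ) (T T' : Finset ι)
    (f f' : ι → κ → ζ → ℂ) :
    ∑ c ∈ s, ∑ z, conj (∑ τ ∈ T, f τ c z) * ∑ τ ∈ T', f' τ c z =
      ∑ τ ∈ T, ∑ τ' ∈ T', ∑ c ∈ s, ∑ z, conj (f τ c z) * f' τ' c z := by
  simp only [map_sum, Finset.sum_mul_sum]
  have e : ∀ c, ∑ z, ∑ τ ∈ T, ∑ τ' ∈ T', conj (f τ c z) * f' τ' c z =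
      ∑ τ ∈ T, ∑ τ' ∈ T', ∑ z, conj (f τ c z) * f' τ' c z := fun c => by
    rw [Finset.sum_comm]
    exact Finset.sum_congr rfl fun τ _ => Finset.sum_comm
  rw [Finset.sum_congr rfl fun c _ => e c, Finset.sum_comm]
  exact Finset.sum_congr rfl fun τ _ => Finset.sum_comm

theorem overlay_eq_splice {S : Finset (Fin N)} {t : ℕ} {τ : Fin N → Option (Fin L)}
    (hτ : τ ∈ histories L S t) (g : ∀ k, I k × O k) {c : Messages L I}
    (hc : VacantBefore t c) : overlay (inputs τ g) c = splice t (inputs τ g) c := by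
  funext k r
  by_cases hr : r.val < t
  · simp [overlay, splice, hr, hc k r hr]
  · have : inputs τ g k r = none :=
      ofHistory_of_ne fun h => hr ((mem_histories.1 hτ).2 k r h)
    simp [overlay, splice, hr, this]

/-- With no answer in round `t`, no agent received in it, so the histories end before `t` and there
is nothing to withhold. -/
theorem historySum_vacuum (S : Finset (Fin N)) (g : ∀ k, I k × O k) (p : P) (t : Fin L)
    (c : Messages L I) (z : Z) :
    historySum amp S g p (t, fun _ => none, c, z) = prefixSum amp S g p t c z := by
  classical
  unfold historySum prefixSum
  rw [← Finset.sum_filter]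
  have h : (histories L S (t + 1)).filter (fun τ => (fun k => outputs τ g k t) = fun _ => none) =
      histories L S t := by
    ext τ
    simp only [Finset.mem_filter, mem_histories, funext_iff, ofHistory_eq_none]
    constructor
    · rintro ⟨⟨h1, h2⟩, h3⟩
      refine ⟨h1, fun k r hr => ?_⟩
      have := h2 k r hr
      have h4 : r ≠ t := fun h => h3 k (h ▸ hr)
      have : r.val ≠ t.val := fun h => h4 (Fin.ext h)
      omega
    · rintro ⟨h1, h2⟩
      refine ⟨⟨h1, fun k r hr => (h2 k r hr).trans (by omega)⟩, fun k hk => ?_⟩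
      exact lt_irrefl _ (h2 k t hk)
  rw [h]
  refine Finset.sum_congr rfl fun τ hτ => ?_
  congr 1
  funext k r
  by_cases hr : r.val < t.val
  · simp [splice, hr]
  · have : outputs τ g k r = none :=
      ofHistory_of_ne fun h => hr ((mem_histories.1 hτ).2 k r h)
    simp only [splice, hr, if_false, this, vacuum]

/-! ### Gram matrices of the prefix sums -/

variable {amp} [∀ k, Fintype (I k)] [Fintype Z]

open Classical in
-- On the left the box has been given the answers of round `t`, on the right they are kept in memory
-- as `x`. By causality these agree on messages after round `t`: cross terms of histories with
-- different answers in round `t` vanish (`causal_zero`), and equal answers may be replaced by the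
-- vacuum (`causal_congr`).
theorem prefixGram_succ [∀ k, Fintype (O k)] (h : IsCausalAmplitude amp) (S : Finset (Fin N))
    (g g' : ∀ k, I k × O k) (p p' : P) (t : Fin L) :
    prefixGram amp S g g' p p' (t + 1) = ∑ x : (∀ k, Option (O k)),
      ∑ c with VacantBefore (t + 1) c, ∑ z,
        conj (historySum amp S g p (t, x, c, z)) * historySum amp S g' p' (t, x, c, z) := by
  unfold prefixGram historySum prefixSum
  simp only [sum_conj_sum_mul_sum]
  rw [Finset.sum_comm (s := (Finset.univ : Finset (∀ k, Option (O k))))]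
  refine Finset.sum_congr rfl fun τ hτ => ?_
  rw [Finset.sum_comm (s := (Finset.univ : Finset (∀ k, Option (O k))))]
  refine Finset.sum_congr rfl fun τ' hτ' => ?_
  rw [Finset.sum_eq_single (fun k => outputs τ g k t) (fun x _ hx => Finset.sum_eq_zero fun c _ =>
    Finset.sum_eq_zero fun z _ => by rw [if_neg (Ne.symm hx), map_zero, zero_mul]) (by simp)]
  simp only [if_true]
  have vac : ∀ (τ : Fin N → Option (Fin L)) (g : ∀ k, I k × O k), τ ∈ histories L S (t + 1) →
      ∀ k r, t.val < r.val → outputs τ g k r = none := fun τ g hτ k r hr =>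
    ofHistory_of_ne fun h => absurd ((mem_histories.1 hτ).2 k r h) (by omega)
  by_cases hrow : (fun k => outputs τ' g' k t) = fun k => outputs τ g k t
  · have hag : AgreeFrom t (outputs τ g) (outputs τ' g') := by
      intro k r hr
      rcases hr.lt_or_eq with hr | hr
      · rw [vac τ g hτ k r hr, vac τ' g' hτ' k r hr]
      · rw [← Fin.ext hr]; exact (congrFun hrow k).symm
    have key := h.causal_congr t t.isLt p p' (outputs τ g) (outputs τ' g')
      (splice t (outputs τ g) vacuum) (splice t (outputs τ' g') vacuum)
      (inputs τ g) (inputs τ' g') hag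
      (fun k r hr => by simp [splice, not_lt.2 hr]) (fun k r hr => by simp [splice, hr])
      (fun k r hr => by simp [splice, hr])
    simp only [hrow, if_true]
    convert key using 2 with c hc c hc
    · rw [Finset.mem_filter] at hc
      rw [overlay_eq_splice hτ g hc.2, overlay_eq_splice hτ' g' hc.2]
    · rw [Finset.mem_filter] at hc
      rw [overlay_eq_splice hτ g hc.2, overlay_eq_splice hτ' g' hc.2]
  · simp only [hrow, if_false, mul_zero, Finset.sum_const_zero]
    have key := h.causal_zero t t.isLt p p' (outputs τ g) (outputs τ' g')
      (inputs τ g) (inputs τ' g') (fun hag => hrow (funext fun k => (hag k t le_rfl).symm))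
    convert key using 2 with c hc
    rw [Finset.mem_filter] at hc
    rw [overlay_eq_splice hτ g hc.2, overlay_eq_splice hτ' g' hc.2]

open Classical in
theorem prefixGram_zero_empty (h : IsCausalAmplitude amp) (g g' : ∀ k, I k × O k) (p p' : P) :
    prefixGram amp ∅ g g' p p' 0 = if p = p' then 1 else 0 := by
  have h1 : histories L (∅ : Finset (Fin N)) 0 = {fun _ => none} := by
    ext τ
    simp only [mem_histories, Finset.mem_singleton, funext_iff, Finset.notMem_empty, iff_false,
      not_not]
    exact ⟨fun h => h.1, fun h => ⟨h, fun k r hr => by simp [h k] at hr⟩⟩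
  have h2 : ∀ g : ∀ k, I k × O k, outputs (fun _ => none : Fin N → Option (Fin L)) g = vacuum :=
    fun g => by funext k r; simp [ofHistory, vacuum]
  have h3 : ∀ (g : ∀ k, I k × O k) c,
      overlay (inputs (fun _ => none : Fin N → Option (Fin L)) g) c = c :=
    fun g c => by funext k r; simp [ofHistory, overlay]
  rw [← h.norm]
  unfold prefixGram prefixSum
  simp only [h1, Finset.sum_singleton, h2, h3]
  refine Finset.sum_congr ?_ fun _ _ => rfl
  ext c
  simp [VacantBefore]

theorem prefixGram_zero_of_nonempty {S : Finset (Fin N)} (hS : S.Nonempty)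
    (g g' : ∀ k, I k × O k) (p p' : P) : prefixGram amp S g g' p p' 0 = 0 := by
  have h1 : histories L S 0 = ∅ := by
    ext τ
    simp only [mem_histories, Finset.notMem_empty, iff_false, not_and]
    obtain ⟨k, hk⟩ := hS
    intro h hr
    obtain ⟨r, h2⟩ := Option.ne_none_iff_exists'.1 ((h k).2 hk)
    exact absurd (hr k r h2) (by omega)
  simp [prefixGram, prefixSum, h1]

/-- The total amplitude of the histories in which all agents have received their message. -/
def finalSum (amp : P → Messages L O → Z → Messages L I → ℂ) (g : ∀ k, I k × O k) (p : P)
    (z : Z) : ℂ :=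
  ∑ τ ∈ histories L Finset.univ L, amp p (outputs τ g) z (inputs τ g)

theorem prefixGram_last (S : Finset (Fin N)) (g g' : ∀ k, I k × O k) (p p' : P) :
    prefixGram amp S g g' p p' L = ∑ z,
      conj (∑ τ ∈ histories L S L, amp p (outputs τ g) z (inputs τ g)) *
        ∑ τ ∈ histories L S L, amp p' (outputs τ g') z (inputs τ g') := by
  classical
  unfold prefixGram
  have h1 : (Finset.univ.filter fun c : Messages L I => VacantBefore L c) = {vacuum} := by
    ext c
    simp only [Finset.mem_filter, Finset.mem_univ, true_and, Finset.mem_singleton]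
    exact ⟨fun h => by funext k r; exact h k r r.isLt, fun h => by subst h; intro k r _; rfl⟩
  have h2 : ∀ y : Messages L I, overlay y vacuum = y := fun y => by
    funext k r; simp [overlay, vacuum]
  rw [h1, Finset.sum_singleton]
  simp only [prefixSum, h2]

/-- An agent outside `S` has received nothing after the last round, which full activity forbids. -/
theorem prefixGram_last_of_ne_univ (h : IsCausalAmplitude amp) {S : Finset (Fin N)}
    (hS : S ≠ Finset.univ) (g g' : ∀ k, I k × O k) (p p' : P) :
    prefixGram amp S g g' p p' L = 0 := by
  rw [prefixGram_last]
  refine Finset.sum_eq_zero fun z _ => ?_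
  rw [Finset.sum_eq_zero (s := histories L S L) (f := fun τ => amp p' _ z _), mul_zero]
  intro τ hτ
  obtain ⟨k, hk⟩ : ∃ k, k ∉ S := by
    by_contra! hall
    exact hS (Finset.eq_univ_of_forall hall)
  refine h.active _ _ _ _ (fun k r _ => by simp only [ofHistory_eq_none]) fun he => ?_
  obtain ⟨r, hr, _⟩ := he k
  rw [Ne, ofHistory_eq_none, not_not] at hr
  exact hk (((mem_histories.1 hτ).1 k).1 (by simp [hr]))

end HistorySums

/-! ### The states of the circuit -/

section States

variable {N L : ℕ} {I O : Fin N → Type} {P Z : Type}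

/-- The answers in memory come from agents before `k`, and the further messages in memory are later
than the one to agent `k` in the current round. -/
def IsPending (k : Fin N) (m : Memory L I O Z) : Prop :=
  (∀ j, m.2.1 j ≠ none → j < k) ∧ VacantBefore m.1 m.2.2.1 ∧ ∀ j ≤ k, m.2.2.1 j m.1 = none

variable (amp : P → Messages L O → Z → Messages L I → ℂ)

open Classical in
/-- The amplitude for agent `k` to receive `i` when the agents in `K` have acted before. -/
def arrival (K : Finset (Fin N)) (k : Fin N) (i : I k) (g : ∀ k, I k × O k) (p : P)
    (m : Memory L I O Z) : ℂ :=
  if IsPending k m then historySum amp K g p (m.1, m.2.1, put m.2.2.1 k m.1 i, m.2.2.2) else 0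

open Classical in
/-- The state after the agents in `S` have acted, by the agent that has acted last. -/
def sent (S : Finset (Fin N)) (g : ∀ k, I k × O k) (p : P) :
    (Σ k, O k × Memory L I O Z) → ℂ := fun q =>
  if q.1 ∈ S ∧ q.2.1 = (g q.1).2 then arrival amp (S.erase q.1) q.1 (g q.1).1 g p q.2.2 else 0

open Classical in
/-- The state before another agent acts when those in `S` have acted. -/
def received (S : Finset (Fin N)) (g : ∀ k, I k × O k) (p : P) :
    (Σ k, I k × Memory L I O Z) → ℂ := fun q =>
  if q.1 ∉ S then arrival amp S q.1 q.2.1 g p q.2.2 else 0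

theorem arrival_congr (K : Finset (Fin N)) (k : Fin N) (i : I k) {g g' : ∀ k, I k × O k}
    (hg : ∀ j ∈ K, g j = g' j) (p : P) (m : Memory L I O Z) :
    arrival amp K k i g p m = arrival amp K k i g' p m := by
  classical
  unfold arrival historySum
  split_ifs with hm
  · refine Finset.sum_congr rfl fun τ hτ => ?_
    have hτg : ∀ j r, τ j = some r → g j = g' j := fun j r hr =>
      hg j (((mem_histories.1 hτ).1 j).1 (by simp [hr]))
    have h1 : outputs τ g = outputs τ g' := by
      funext j r
      by_cases hr : τ j = some r
      · simp [ofHistory, hr, hτg j r hr]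
      · simp [ofHistory, hr]
    have h2 : inputs τ g = inputs τ g' := by
      funext j r
      by_cases hr : τ j = some r
      · simp [ofHistory, hr, hτg j r hr]
      · simp [ofHistory, hr]
    rw [h1, h2]
  · rfl

/-- An undelivered message to `k` in round `t` can be reinterpreted as part of the history, with `τ
k = some t`. The box amplitude is the same because answers of round `t` are withheld from it; the
answer of `k` appears only in the memory. -/
theorem historySum_put {S : Finset (Fin N)} {k : Fin N} (hk : k ∈ S) (g : ∀ k, I k × O k) (p : P)
    {m : Memory L I O Z} (hm : IsPending k m) :
    historySum amp (S.erase k) g p (m.1, m.2.1, put m.2.2.1 k m.1 (g k).1, m.2.2.2) =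
      historySum amp S g p
        (m.1, Function.update m.2.1 k (some (g k).2), m.2.2.1, m.2.2.2) := by
  classical
  obtain ⟨t, x, c, z⟩ := m
  obtain ⟨hx, -, hc⟩ := hm
  dsimp only at hx hc ⊢
  have hxk : x k = none := by
    by_contra h
    exact lt_irrefl _ (hx k h)
  unfold historySum
  dsimp only
  rw [← Finset.sum_filter, ← Finset.sum_filter]
  refine Finset.sum_bij' (fun τ _ => Function.update τ k (some t))
    (fun τ _ => Function.update τ k none) ?_ ?_ ?_ ?_ ?_
  · intro τ hτ
    simp only [Finset.mem_filter, mem_histories, Finset.mem_erase] at hτ ⊢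
    obtain ⟨⟨h1, h2⟩, h3⟩ := hτ
    refine ⟨⟨fun j => ?_, fun j r => ?_⟩, ?_⟩
    · by_cases hj : j = k
      · subst hj; simp [hk]
      · simp [hj, h1 j]
    · by_cases hj : j = k
      · subst hj
        simp only [Function.update_self, Option.some.injEq]
        rintro rfl; omega
      · simpa [hj] using h2 j r
    · subst h3
      funext j
      by_cases hj : j = k
      · subst hj; simp [ofHistory]
      · simp [ofHistory, hj]
  · intro τ hτ
    simp only [Finset.mem_filter, mem_histories, Finset.mem_erase] at hτ ⊢
    obtain ⟨⟨h1, h2⟩, h3⟩ := hτ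
    refine ⟨⟨fun j => ?_, fun j r => ?_⟩, ?_⟩
    · by_cases hj : j = k
      · subst hj; simp
      · simp [hj, h1 j]
    · by_cases hj : j = k
      · subst hj; simp
      · simpa [hj] using h2 j r
    · funext j
      by_cases hj : j = k
      · subst hj; simp [ofHistory, hxk]
      · have := congrFun h3 j
        simpa [ofHistory, hj] using this
  · intro τ hτ
    simp only [Finset.mem_filter, mem_histories, Finset.mem_erase] at hτ
    have : τ k = none := by
      by_contra h
      exact ((hτ.1.1 k).1 h).1 rfl
    simp [← this]
  · intro τ hτ
    simp only [Finset.mem_filter, mem_histories] at hτ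
    have : τ k = some t := by
      have := congrFun hτ.2 k
      by_contra h
      simp [ofHistory, h] at this
    simp [← this]
  · intro τ hτ
    simp only [Finset.mem_filter, mem_histories, Finset.mem_erase] at hτ
    have hτk : τ k = none := by
      by_contra h
      exact ((hτ.1.1 k).1 h).1 rfl
    congr 1
    · funext j r
      by_cases hj : j = k
      · subst hj
        by_cases hr : r.val < t.val
        · have : t ≠ r := fun h => by subst h; omega
          simp [splice, hr, ofHistory, hτk, this]
        · simp [splice, hr]
      · simp [splice, ofHistory, hj]
    · funext j r
      by_cases hj : j = k
      · subst hj
        by_cases hr : r = t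
        · subst hr; simp [overlay, ofHistory, hτk]
        · have h2 : put c j t (g j).1 j r = c j r := put_of_ne _ _ (Or.inr hr)
          simp [overlay, ofHistory, hτk, h2, Ne.symm hr]
      · have h2 : put c k t (g k).1 j r = c j r := put_of_ne _ _ (Or.inl hj)
        simp [overlay, ofHistory, hj, h2]

open Classical in
-- The conditions on `S` and on the answer in `sent` are enforced by the history sum itself: the
-- answer of `k` in the memory must be the one its history produces.
theorem sent_eq (S : Finset (Fin N)) (g : ∀ k, I k × O k) (p : P) (k : Fin N) (o : O k)
    (m : Memory L I O Z) :
    sent amp S g p ⟨k, o, m⟩ = if IsPending k m then historySum amp S g p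
      (m.1, Function.update m.2.1 k (some o), m.2.2.1, m.2.2.2) else 0 := by
  unfold sent arrival
  dsimp only
  by_cases hm : IsPending k m
  · simp only [hm, if_true]
    split_ifs with h
    · rw [h.2, historySum_put amp h.1 g p hm]
    · symm
      unfold historySum
      refine Finset.sum_eq_zero fun τ hτ => if_neg fun hrow => h ?_
      have := congrFun hrow k
      simp only [Function.update_self, ofHistory] at this
      split_ifs at this with hτk
      exact ⟨((mem_histories.1 hτ).1 k).1 (by simp [hτk]), (Option.some.inj this).symm⟩
  · simp [hm]

open Classical in
-- The condition `k ∉ S` in `received` can be dropped: otherwise `k` would get a second message, and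
-- the amplitude vanishes by full activity.
theorem received_eq [∀ k, Fintype (I k)] [Fintype Z] [∀ k, Nonempty (O k)] {amp}
    (h : IsCausalAmplitude amp) (S : Finset (Fin N)) (g : ∀ k, I k × O k) (p : P) (k : Fin N)
    (i : I k) (m : Memory L I O Z) :
    received amp S g p ⟨k, i, m⟩ = if IsPending k m then historySum amp S g p
      (m.1, m.2.1, put m.2.2.1 k m.1 i, m.2.2.2) else 0 := by
  unfold received arrival
  dsimp only
  by_cases hk : k ∈ S
  · simp only [hk, not_true, if_false]
    split_ifs with hm
    · symm
      obtain ⟨t, x, c, z⟩ := m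
      obtain ⟨hx, hc, -⟩ := hm
      dsimp only at hx hc ⊢
      unfold historySum
      dsimp only
      refine Finset.sum_eq_zero fun τ hτ => ?_
      split_ifs with hrow
      · obtain ⟨r, hr⟩ := Option.ne_none_iff_exists'.1 (((mem_histories.1 hτ).1 k).2 hk)
        have hr1 : r.val < t + 1 := (mem_histories.1 hτ).2 k r hr
        -- Had `k` received in round `t` already, its answer would be in `x`, but all answers in `x`
        -- come from agents before `k`.
        have hrt : r ≠ t := by
          rintro rfl
          refine lt_irrefl k (hx k ?_)
          rw [← hrow]
          simp [ofHistory, hr]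
        have hy1 : overlay (inputs τ g) (put c k t i) k r ≠ none := by
          simp [overlay, ofHistory, hr]
        have hy2 : overlay (inputs τ g) (put c k t i) k t ≠ none := by
          simp [overlay]
        refine h.eq_zero t t.isLt p _ z _ ?_ ?_
        · intro j s hs
          have : put c k t i j s = c j s := put_of_ne _ _ (Or.inr fun h => by subst h; omega)
          simp only [splice, hs, if_true, overlay, this, hc j s hs, Option.or_none,
            ofHistory_eq_none]
        · intro y' hy' he
          have e1 := hy' k r hr1
          have e2 := hy' k t (by omega)
          exact hrt ((he k).unique (by rwa [← e1]) (by rwa [← e2]))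
      · rfl
    · rfl
  · simp [hk]

/-- The further messages in memory are later than the answers in memory. -/
def IsOrdered (m : Memory L I O Z) : Prop :=
  VacantBefore m.1 m.2.2.1 ∧ ∀ j j', m.2.1 j ≠ none → m.2.2.1 j' m.1 ≠ none → j < j'

variable [∀ k, Fintype (I k)] [∀ k, Fintype (O k)] [Fintype Z]

open Classical in
-- The inverse of the reindexing takes out the answer of the agent with the largest index, the one
-- that acted last.
theorem sum_pending_sent (φ : Memory L I O Z → ℂ) :
    ∑ q : (Σ k, O k × Memory L I O Z), (if IsPending q.1 q.2.2 then
      φ (q.2.2.1, Function.update q.2.2.2.1 q.1 (some q.2.1), q.2.2.2.2.1, q.2.2.2.2.2) else 0) =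
    ∑ m with IsOrdered m ∧ ∃ j, m.2.1 j ≠ none, φ m := by
  rw [← Finset.sum_filter]
  refine Finset.sum_bij (fun q _ => (q.2.2.1, Function.update q.2.2.2.1 q.1 (some q.2.1),
    q.2.2.2.2.1, q.2.2.2.2.2)) ?_ ?_ ?_ (fun _ _ => rfl)
  · rintro ⟨k, o, t, x, c, z⟩ hq
    simp only [Finset.mem_filter, Finset.mem_univ, true_and] at hq ⊢
    obtain ⟨h1, h2, h3⟩ := hq
    refine ⟨⟨h2, fun j j' hj hj' => ?_⟩, k, by simp⟩
    have hkj : k < j' := lt_of_not_ge fun h => hj' (h3 j' h)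
    by_cases hjk : j = k
    · exact hjk ▸ hkj
    · exact (h1 j (by simpa [hjk] using hj)).trans hkj
  · rintro ⟨k, o, t, x, c, z⟩ hq ⟨k', o', t', x', c', z'⟩ hq' he
    simp only [Finset.mem_filter, Finset.mem_univ, true_and] at hq hq'
    simp only [Prod.mk.injEq] at he
    obtain ⟨rfl, hx, rfl, rfl⟩ := he
    have h1 := hq.1
    have h1' := hq'.1
    dsimp only at h1 h1'
    have hle : ∀ {k k' : Fin N} {o : O k} {o' : O k'} {x x' : ∀ k, Option (O k)},
        (∀ j, x' j ≠ none → j < k') →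
        Function.update x k (some o) = Function.update x' k' (some o') → k ≤ k' := by
      intro k k' o o' x x' h1' hx
      by_contra hlt
      have hne : k ≠ k' := fun h => hlt h.le
      have := congrFun hx k
      rw [Function.update_self, Function.update_of_ne hne] at this
      exact hlt (h1' k (by rw [← this]; simp)).le
    obtain rfl : k = k' := le_antisymm (hle h1' hx) (hle h1 hx.symm)
    have ho : o = o' := by simpa using congrFun hx k
    have hxx : x = x' := by
      funext j
      by_cases hj : j = k
      · subst hj
        have e1 : x j = none := by
          by_contra h; exact lt_irrefl _ (h1 j h)
        have e2 : x' j = none := by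
          by_contra h; exact lt_irrefl _ (h1' j h)
        rw [e1, e2]
      · simpa [hj] using congrFun hx j
    rw [ho, hxx]
  · rintro ⟨t, x, c, z⟩ hm
    simp only [Finset.mem_filter, Finset.mem_univ, true_and] at hm
    obtain ⟨⟨h1, h2⟩, h3⟩ := hm
    dsimp only at h1 h2 h3
    let s : Finset (Fin N) := {j | x j ≠ none}
    have hs : s.Nonempty := h3.imp fun j hj => by simpa [s] using hj
    set k := s.max' hs with hk
    have hxk : x k ≠ none := by simpa [s] using s.max'_mem hs
    obtain ⟨o, ho⟩ := Option.ne_none_iff_exists'.1 hxk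
    refine ⟨⟨k, o, t, Function.update x k none, c, z⟩, ?_, ?_⟩
    · simp only [Finset.mem_filter, Finset.mem_univ, true_and]
      refine ⟨fun j hj => ?_, h1, fun j hj => ?_⟩
      · have hjk : j ≠ k := fun h => hj (by rw [h]; exact Function.update_self ..)
        have : x j ≠ none := by simpa [hjk] using hj
        exact lt_of_le_of_ne (s.le_max' j (by simpa [s] using this)) hjk
      · by_contra h
        exact absurd (h2 k j hxk h) (not_lt.2 hj)
    · simp [← ho]

open Classical in
-- The inverse of the reindexing takes out the message of the current round to the agent with the
-- smallest index, the next one to act.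
theorem sum_pending_received (φ : Memory L I O Z → ℂ) :
    ∑ q : (Σ k, I k × Memory L I O Z), (if IsPending q.1 q.2.2 then
      φ (q.2.2.1, q.2.2.2.1, put q.2.2.2.2.1 q.1 q.2.2.1 q.2.1, q.2.2.2.2.2) else 0) =
    ∑ m with IsOrdered m ∧ ∃ j, m.2.2.1 j m.1 ≠ none, φ m := by
  rw [← Finset.sum_filter]
  refine Finset.sum_bij (fun q _ => (q.2.2.1, q.2.2.2.1, put q.2.2.2.2.1 q.1 q.2.2.1 q.2.1,
    q.2.2.2.2.2)) ?_ ?_ ?_ (fun _ _ => rfl)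
  · rintro ⟨k, i, t, x, c, z⟩ hq
    simp only [Finset.mem_filter, Finset.mem_univ, true_and] at hq ⊢
    obtain ⟨h1, h2, h3⟩ := hq
    dsimp only at h1 h2 h3
    refine ⟨⟨fun j r hr => ?_, fun j j' hj hj' => ?_⟩, k, by simp⟩
    · rw [← h2 j r hr]
      exact put_of_ne _ _ (Or.inr fun h => by subst h; exact lt_irrefl _ hr)
    · by_cases hjk : j' = k
      · exact hjk ▸ h1 j hj
      · dsimp only at hj'
        rw [put_of_ne _ _ (Or.inl hjk)] at hj'
        exact (h1 j hj).trans (lt_of_not_ge fun h => hj' (h3 j' h))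
  · rintro ⟨k, i, t, x, c, z⟩ hq ⟨k', i', t', x', c', z'⟩ hq' he
    simp only [Finset.mem_filter, Finset.mem_univ, true_and] at hq hq'
    simp only [Prod.mk.injEq] at he
    obtain ⟨rfl, rfl, hc, rfl⟩ := he
    have h3 := hq.2.2
    have h3' := hq'.2.2
    dsimp only at h3 h3'
    have hle : ∀ {k k' : Fin N} {i : I k} {i' : I k'} {c c' : Messages L I},
        (∀ j ≤ k', c' j t = none) → put c k t i = put c' k' t i' → k' ≤ k := by
      intro k k' i i' c c' h3' hc
      by_contra hlt
      have hne : k ≠ k' := fun h => hlt h.ge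
      have := congrFun (congrFun hc k) t
      rw [put_self, put_of_ne _ _ (Or.inl hne), h3' k (not_le.1 hlt).le] at this
      simp at this
    obtain rfl : k = k' := le_antisymm (hle h3 hc.symm) (hle h3' hc)
    have hi : i = i' := by simpa using congrFun (congrFun hc k) t
    have hcc : c = c' := by
      funext j r
      by_cases hj : j = k ∧ r = t
      · rw [hj.1, hj.2, h3 k le_rfl, h3' k le_rfl]
      · have := congrFun (congrFun hc j) r
        rwa [put_of_ne _ _ (not_and_or.1 hj), put_of_ne _ _ (not_and_or.1 hj)] at this
    rw [hi, hcc]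
  · rintro ⟨t, x, c, z⟩ hm
    simp only [Finset.mem_filter, Finset.mem_univ, true_and] at hm
    obtain ⟨⟨h1, h2⟩, h3⟩ := hm
    dsimp only at h1 h2 h3
    let s : Finset (Fin N) := {j | c j t ≠ none}
    have hs : s.Nonempty := h3.imp fun j hj => by simpa [s] using hj
    set k := s.min' hs with hk
    have hck : c k t ≠ none := by simpa [s] using s.min'_mem hs
    obtain ⟨i, hi⟩ := Option.ne_none_iff_exists'.1 hck
    have hne : ∀ {j r}, j ≠ k ∨ r ≠ t →
        Function.update c k (Function.update (c k) t none) j r = c j r := by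
      intro j r h
      by_cases hj : j = k
      · subst hj
        have hr : r ≠ t := h.resolve_left (by simp)
        simp [hr]
      · simp [hj]
    refine ⟨⟨k, i, t, x, Function.update c k (Function.update (c k) t none), z⟩, ?_, ?_⟩
    · simp only [Finset.mem_filter, Finset.mem_univ, true_and]
      refine ⟨fun j hj => h2 j k hj hck, fun j r hr => ?_, fun j hj => ?_⟩
      · have : r ≠ t := fun h => by subst h; exact lt_irrefl _ hr
        dsimp only
        rw [hne (Or.inr this), h1 j r hr]
      · by_cases hjk : j = k
        · subst hjk; simp
        · dsimp only
          rw [hne (Or.inl hjk)]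
          by_contra h
          exact hjk (le_antisymm hj (s.min'_le j (by simpa [s] using h)))
    · simp only [Prod.mk.injEq, true_and, and_true]
      funext j r
      by_cases hj : j = k ∧ r = t
      · obtain ⟨rfl, rfl⟩ := hj
        rw [put_self, hi]
      · rw [put_of_ne _ _ (not_and_or.1 hj), hne (not_and_or.1 hj)]

open Classical in
/-- Conservation of inner products by the step between the agents in `S` and the next one. -/
theorem gram_sent_add [∀ k, Nonempty (O k)]
    {amp : P → Messages L O → Z → Messages L I → ℂ} (h : IsCausalAmplitude amp)
    (S : Finset (Fin N)) (g g' : ∀ k, I k × O k) (p p' : P) :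
    star (sent amp S g p) ⬝ᵥ sent amp S g' p' + prefixGram amp S g g' p p' 0 =
      star (received amp S g p) ⬝ᵥ received amp S g' p' + prefixGram amp S g g' p p' L := by
  let φ : Memory L I O Z → ℂ := fun m => conj (historySum amp S g p m) * historySum amp S g' p' m
  have hsent : star (sent amp S g p) ⬝ᵥ sent amp S g' p' =
      ∑ m with IsOrdered m ∧ ∃ j, m.2.1 j ≠ none, φ m := by
    rw [← sum_pending_sent]
    refine Finset.sum_congr rfl fun ⟨k, o, m⟩ _ => ?_
    rw [Pi.star_apply, sent_eq, sent_eq]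
    split_ifs <;> simp [φ]
  have hrec : star (received amp S g p) ⬝ᵥ received amp S g' p' =
      ∑ m with IsOrdered m ∧ ∃ j, m.2.2.1 j m.1 ≠ none, φ m := by
    rw [← sum_pending_received]
    refine Finset.sum_congr rfl fun ⟨k, o, m⟩ _ => ?_
    rw [Pi.star_apply, received_eq h, received_eq h]
    split_ifs <;> simp [φ]
  have hfirst : ∑ m with IsOrdered m ∧ ¬ ∃ j, m.2.1 j ≠ none, φ m =
      ∑ t : Fin L, prefixGram amp S g g' p p' t := by
    rw [Finset.sum_filter, Fintype.sum_prod_type]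
    refine Finset.sum_congr rfl fun t _ => ?_
    rw [Fintype.sum_prod_type, Finset.sum_eq_single (fun _ => none : ∀ k, Option (O k)),
      Fintype.sum_prod_type,
      prefixGram, Finset.sum_filter]
    · refine Finset.sum_congr rfl fun c _ => ?_
      by_cases hc : VacantBefore t c
      · simp [IsOrdered, hc, φ, historySum_vacuum]
      · simp [IsOrdered, hc]
    · intro x _ hx
      obtain ⟨j, hj⟩ := Function.ne_iff.1 hx
      refine Finset.sum_eq_zero fun q _ => if_neg fun hh => hh.2 ⟨j, hj⟩
    · simp
  have hlast : ∑ m with IsOrdered m ∧ ¬ ∃ j, m.2.2.1 j m.1 ≠ none, φ m =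
      ∑ t : Fin L, prefixGram amp S g g' p p' (t + 1) := by
    rw [Finset.sum_filter, Fintype.sum_prod_type]
    refine Finset.sum_congr rfl fun t _ => ?_
    rw [Fintype.sum_prod_type, prefixGram_succ h]
    refine Finset.sum_congr rfl fun x _ => ?_
    rw [Fintype.sum_prod_type, Finset.sum_filter]
    refine Finset.sum_congr rfl fun c _ => ?_
    by_cases hc : VacantBefore (t + 1) c
    · have h1 : ∀ j, c j t = none := fun j => hc j t (by omega)
      have h2 : VacantBefore t c := fun j r hr => hc j r (by omega)
      simp [IsOrdered, hc, h1, h2, φ]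
    · rw [if_neg hc]
      refine Finset.sum_eq_zero fun z _ => if_neg fun hh => hc fun j r hr => ?_
      rcases Nat.lt_succ_iff_lt_or_eq.1 hr with hr | hr
      · exact hh.1.1 j r hr
      · have := hh.2
        push Not at this
        rw [Fin.ext hr]
        exact this j
  -- The same sum over ordered memory states is split in two ways, by presence of an answer and by
  -- presence of a remaining message; `e3` telescopes the difference.
  have e1 := Finset.sum_filter_add_sum_filter_not
    (Finset.univ.filter fun m : Memory L I O Z => IsOrdered m) (fun m => ∃ j, m.2.1 j ≠ none) φ
  have e2 := Finset.sum_filter_add_sum_filter_not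
    (Finset.univ.filter fun m : Memory L I O Z => IsOrdered m)
    (fun m => ∃ j, m.2.2.1 j m.1 ≠ none) φ
  rw [Finset.filter_filter, Finset.filter_filter, hfirst, ← hsent,
    Fin.sum_univ_eq_sum_range (fun t => prefixGram amp S g g' p p' t)] at e1
  rw [Finset.filter_filter, Finset.filter_filter, hlast, ← hrec,
    Fin.sum_univ_eq_sum_range (fun t => prefixGram amp S g g' p p' (t + 1))] at e2
  have e3 := Finset.sum_range_succ (fun t => prefixGram amp S g g' p p' t) L
  rw [Finset.sum_range_succ'] at e3
  linear_combination e1 - e2 + e3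

end States

/-! ### Inner products of the states -/

section Gram

variable {N L : ℕ} {I O : Fin N → Type} {P Z : Type} [∀ k, Fintype (I k)] [∀ k, Fintype (O k)]
  [Fintype Z] [∀ k, Nonempty (O k)] {amp : P → Messages L O → Z → Messages L I → ℂ}

theorem gram_sent_eq_gram_received (h : IsCausalAmplitude amp) {S : Finset (Fin N)}
    (hS : S.Nonempty) (hS' : S ≠ Finset.univ) (g g' : ∀ k, I k × O k) (p p' : P) :
    star (sent amp S g p) ⬝ᵥ sent amp S g' p' =
      star (received amp S g p) ⬝ᵥ received amp S g' p' := by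
  have := gram_sent_add h S g g' p p'
  rwa [prefixGram_zero_of_nonempty hS, prefixGram_last_of_ne_univ h hS', add_zero,
    add_zero] at this

open Classical in
theorem gram_received_empty (h : IsCausalAmplitude amp) (hN : 0 < N) (g g' : ∀ k, I k × O k)
    (p p' : P) :
    star (received amp ∅ g p) ⬝ᵥ received amp ∅ g' p' = if p = p' then 1 else 0 := by
  have := gram_sent_add h ∅ g g' p p'
  have hne : (∅ : Finset (Fin N)) ≠ Finset.univ := fun he => by
    have := Finset.mem_univ (⟨0, hN⟩ : Fin N)
    simp [← he] at this
  have hsent : sent amp ∅ g p = 0 := by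
    funext q; simp [sent]
  rw [prefixGram_zero_empty h, prefixGram_last_of_ne_univ h hne, hsent, star_zero,
    zero_dotProduct, zero_add, add_zero] at this
  exact this.symm

theorem gram_sent_univ (h : IsCausalAmplitude amp) (hN : 0 < N) (g g' : ∀ k, I k × O k)
    (p p' : P) :
    star (sent amp Finset.univ g p) ⬝ᵥ sent amp Finset.univ g' p' =
      star (finalSum amp g p) ⬝ᵥ finalSum amp g' p' := by
  have := gram_sent_add h Finset.univ g g' p p'
  have hrec : received amp Finset.univ g p = 0 := by
    funext q; simp [received]
  rw [prefixGram_zero_of_nonempty ⟨⟨0, hN⟩, Finset.mem_univ _⟩, prefixGram_last, hrec, star_zero,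
    zero_dotProduct, zero_add, add_zero] at this
  rw [this]
  rfl

/-- One matrix per `S` has to serve all `g` and `p` at once, hence the need for all mixed inner
products and not only for norms. -/
theorem exists_step_matrix (h : IsCausalAmplitude amp) :
    ∃ M : Finset (Fin N) → Matrix (Σ k, I k × Memory L I O Z) (Σ k, O k × Memory L I O Z) ℂ,
      ∀ S, S.Nonempty → S ≠ Finset.univ → ∀ g p, M S *ᵥ sent amp S g p = received amp S g p := by
  classical
  have : ∀ S : Finset (Fin N), ∃ M : Matrix (Σ k, I k × Memory L I O Z)
      (Σ k, O k × Memory L I O Z) ℂ, S.Nonempty → S ≠ Finset.univ →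
        ∀ g p, M *ᵥ sent amp S g p = received amp S g p := by
    intro S
    by_cases hS : S.Nonempty ∧ S ≠ Finset.univ
    · obtain ⟨M, hM⟩ := exists_matrix_mulVec_eq
        (fun j : (∀ k, I k × O k) × P => sent amp S j.1 j.2)
        (fun j : (∀ k, I k × O k) × P => received amp S j.1 j.2)
        (fun j j' => gram_sent_eq_gram_received h hS.1 hS.2 _ _ _ _)
      exact ⟨M, fun _ _ g p => hM (g, p)⟩
    · exact ⟨0, fun h1 h2 => absurd ⟨h1, h2⟩ hS⟩
  choose M hM using this
  exact ⟨M, hM⟩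

theorem exists_last_matrix (h : IsCausalAmplitude amp) (hN : 0 < N) :
    ∃ M : Matrix Z (Σ k, O k × Memory L I O Z) ℂ,
      ∀ g p, M *ᵥ sent amp Finset.univ g p = finalSum amp g p := by
  classical
  obtain ⟨M, hM⟩ := exists_matrix_mulVec_eq
    (fun j : (∀ k, I k × O k) × P => sent amp Finset.univ j.1 j.2)
    (fun j : (∀ k, I k × O k) × P => finalSum amp j.1 j.2)
    (fun j j' => gram_sent_univ h hN _ _ _ _)
  exact ⟨M, fun g p => hM (g, p)⟩

end Gram

/-! ### Sums over the control system and over local basis states -/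

section Sums

variable {N : ℕ}

/-- A control state `(K, k)` with `insert k K = S` is determined by `k ∈ S`, as then `K = S.erase
k`. -/
theorem sum_control_insert {n : ℕ} {S : Finset (Fin N)} (hS : S.card = n) (f : Fin N → ℂ)
    (hf : ∀ k ∉ S, f k = 0) :
    ∑ c : Control N n, (if S = insert c.1.2 c.1.1 then f c.1.2 else 0) = ∑ k, f k := by
  classical
  rw [← Finset.sum_subset (Finset.subset_univ S) fun k _ hk => hf k hk, ← Finset.sum_filter]
  refine Finset.sum_bij (fun c _ => c.1.2) ?_ ?_ ?_ (fun _ _ => rfl)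
  · intro c hc
    rw [(Finset.mem_filter.1 hc).2]
    exact Finset.mem_insert_self _ _
  · intro c hc c' hc' he
    have h1 := (Finset.mem_filter.1 hc).2
    have h2 := (Finset.mem_filter.1 hc').2
    have e1 : c.1.1 = S.erase c.1.2 := by rw [h1, Finset.erase_insert c.2.2]
    have e2 : c'.1.1 = S.erase c'.1.2 := by rw [h2, Finset.erase_insert c'.2.2]
    exact Subtype.ext (Prod.ext (by rw [e1, e2, he]) he)
  · intro k hk
    refine ⟨⟨(S.erase k, k), ?_, Finset.notMem_erase _ _⟩, ?_, rfl⟩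
    · rw [Finset.card_erase_add_one hk, hS]
    · simp [Finset.insert_erase hk]

theorem sum_control_eq {n : ℕ} {S : Finset (Fin N)} (hS : S.card + 1 = n) (f : Fin N → ℂ)
    (hf : ∀ k ∈ S, f k = 0) :
    ∑ c : Control N n, (if c.1.1 = S then f c.1.2 else 0) = ∑ k, f k := by
  classical
  rw [← Finset.sum_subset (Finset.subset_univ (Finset.univ.filter (· ∉ S)))
    fun k _ hk => hf k (by simpa using hk), ← Finset.sum_filter]
  refine Finset.sum_bij (fun c _ => c.1.2) ?_ ?_ ?_ (fun _ _ => rfl)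
  · intro c hc
    rw [← (Finset.mem_filter.1 hc).2]
    simpa using c.2.2
  · intro c hc c' hc' he
    exact Subtype.ext
      (Prod.ext ((Finset.mem_filter.1 hc).2.trans (Finset.mem_filter.1 hc').2.symm) he)
  · intro k hk
    exact ⟨⟨(S, k), hS, by simpa using hk⟩, by simp, rfl⟩

/-- Splits off the sum over the coordinate `k`, with `d` as a placeholder value for it in the outer
sum. -/
theorem sum_eq_sum_update {X : Fin N → Type} [∀ k, Fintype (X k)] [∀ k, DecidableEq (X k)]
    (k : Fin N) (d : X k) (f : (∀ j, X j) → ℂ) :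
    ∑ g, f g = ∑ g : (∀ j, X j), if g k = d then ∑ x, f (Function.update g k x) else 0 := by
  rw [← Finset.sum_filter, ← Finset.sum_product']
  refine (Finset.sum_bij (fun q _ => Function.update q.1 k q.2) (by simp) ?_ ?_ (by simp)).symm
  · rintro ⟨g, x⟩ hg ⟨g', x'⟩ hg' he
    simp only [Finset.mem_product, Finset.mem_filter, Finset.mem_univ, true_and, and_true]
      at hg hg'
    have hx : x = x' := by simpa using congrFun he k
    have hgg : g = g' := by
      funext j
      by_cases hj : j = k
      · subst hj; rw [hg, hg']
      · simpa [hj] using congrFun he j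
    rw [hx, hgg]
  · intro g _
    exact ⟨(Function.update g k d, g k), by simp, by simp⟩

variable {I O : Fin N → Type} [∀ k, DecidableEq (I k)] [∀ k, DecidableEq (O k)]

/-- The coefficients of the operators `A` of the agents in `K`, with the states of the other agents
fixed to be those in `d`. -/
def localWeight (d : ∀ k, I k × O k) (A : ∀ k, Matrix (O k) (I k) ℂ) (K : Finset (Fin N))
    (g : ∀ k, I k × O k) : ℂ :=
  ∏ j, if j ∈ K then A j (g j).2 (g j).1 else if g j = d j then 1 else 0

theorem localWeight_update {d : ∀ k, I k × O k} (A : ∀ k, Matrix (O k) (I k) ℂ)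
    {K : Finset (Fin N)} {k : Fin N} (hk : k ∉ K) {g : ∀ k, I k × O k} (hg : g k = d k)
    (x : I k × O k) :
    localWeight d A (insert k K) (Function.update g k x) = A k x.2 x.1 * localWeight d A K g := by
  unfold localWeight
  rw [← Finset.mul_prod_erase _ _ (Finset.mem_univ k),
    ← Finset.mul_prod_erase (a := k) (f := fun j => if j ∈ K then _ else _) _ (Finset.mem_univ k)]
  rw [if_pos (Finset.mem_insert_self _ _), if_neg hk, if_pos hg, one_mul, Function.update_self]
  congr 1
  refine Finset.prod_congr rfl fun j hj => ?_
  have hjk : j ≠ k := Finset.ne_of_mem_erase hj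
  simp [hjk]

theorem localWeight_eq_zero {d : ∀ k, I k × O k} (A : ∀ k, Matrix (O k) (I k) ℂ)
    {K : Finset (Fin N)} {k : Fin N} (hk : k ∉ K) {g : ∀ k, I k × O k} (hg : g k ≠ d k) :
    localWeight d A K g = 0 :=
  Finset.prod_eq_zero (Finset.mem_univ k) (by rw [if_neg hk, if_neg hg])

theorem localWeight_empty (d : ∀ k, I k × O k) (A : ∀ k, Matrix (O k) (I k) ℂ)
    (g : ∀ k, I k × O k) : localWeight d A ∅ g = if g = d then 1 else 0 := by
  simp only [localWeight, Finset.notMem_empty, if_false, Finset.prod_ite_zero,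
    Finset.prod_const_one, Finset.mem_univ, true_implies, funext_iff]

/-- The action of agent `k` on the expansion in matrix units: the placeholder `d k` gives way to a
sum over the entries of `A k`. The rest of the state must not depend on `g k`, as `k` had not acted.
-/
theorem sum_localWeight_insert [∀ k, Fintype (I k)] [∀ k, Fintype (O k)]
    (d : ∀ k, I k × O k) (A : ∀ k, Matrix (O k) (I k) ℂ) {K : Finset (Fin N)} {k : Fin N}
    (hk : k ∉ K) (f : I k → (∀ k, I k × O k) → ℂ)
    (hf : ∀ i g x, f i (Function.update g k x) = f i g) (o : O k) :
    ∑ g, localWeight d A (insert k K) g * (if o = (g k).2 then f (g k).1 g else 0) =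
      ∑ i, A k o i * ∑ g, localWeight d A K g * f i g := by
  rw [sum_eq_sum_update k (d k)]
  simp only [Finset.mul_sum]
  rw [Finset.sum_comm]
  refine Finset.sum_congr rfl fun g _ => ?_
  split_ifs with hg
  · simp only [localWeight_update A hk hg, Function.update_self, hf]
    rw [Fintype.sum_prod_type]
    refine Finset.sum_congr rfl fun i _ => ?_
    simp [mul_assoc]
  · simp [localWeight_eq_zero A hk hg]

end Sums

/-! ### The circuit -/

theorem ControlledCircuit.agents_mul_apply {N : ℕ} {I O : Fin N → Type} {P Z : Type}
    [∀ k, Fintype (I k)] {n : ℕ} (Q : ControlledCircuit N I O P Z)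
    (A : ∀ k, Matrix (O k) (I k) ℂ) (U : Matrix (Q.Before n) P ℂ) (q : Q.After n) (p : P) :
    (Q.agents A n * U) q p = ∑ i, A q.1.1.2 q.2.1 i * U ⟨q.1, i, q.2.2⟩ p := by
  obtain ⟨c, o, m⟩ := q
  rw [mul_apply, Fintype.sum_sigma, Finset.sum_eq_single c]
  · rw [Fintype.sum_prod_type]
    refine Finset.sum_congr rfl fun i _ => ?_
    simp [ControlledCircuit.agents, blockDiagonal'_apply_eq, kroneckerMap_apply, one_apply]
  · intro c' _ hc'
    refine Finset.sum_eq_zero fun x _ => ?_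
    rw [ControlledCircuit.agents, blockDiagonal'_apply_ne _ _ _ (Ne.symm hc'), zero_mul]
  · simp

section Circuit

variable {N L : ℕ} {I O : Fin N → Type} {P Z : Type} [∀ k, Fintype (I k)] [∀ k, Fintype (O k)]
  [Fintype Z]

/-- The circuit with the internal operations `M S`, applied when the agents in `S` have acted, and
`M'`, applied at the end. -/
abbrev historyCircuit (amp : P → Messages L O → Z → Messages L I → ℂ) (d : ∀ k, I k × O k)
    (M : Finset (Fin N) → Matrix (Σ k, I k × Memory L I O Z) (Σ k, O k × Memory L I O Z) ℂ)
    (M' : Matrix Z (Σ k, O k × Memory L I O Z) ℂ) : ControlledCircuit N I O P Z where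
  α _ := Memory L I O Z
  decidableEqα _ := Classical.decEq _
  first k := Matrix.of fun q p => arrival amp ∅ k q.1 d p q.2
  step _ K k k' := Matrix.of fun y x => M (insert k K) ⟨k', y⟩ ⟨k, x⟩
  last k := Matrix.of fun z x => M' z ⟨k, x⟩

variable {amp : P → Messages L O → Z → Messages L I → ℂ} {d : ∀ k, I k × O k}
  {M : Finset (Fin N) → Matrix (Σ k, I k × Memory L I O Z) (Σ k, O k × Memory L I O Z) ℂ}
  {M' : Matrix Z (Σ k, O k × Memory L I O Z) ℂ}

/-- The recursion for the partial vector is multiplication of `sent` by `M K`, since `sent` is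
supported on last agents `l ∈ K` with answer `(g l).2`. -/
theorem partialVector_historyCircuit
    (hM : ∀ S, S.Nonempty → S ≠ Finset.univ → ∀ g p, M S *ᵥ sent amp S g p = received amp S g p)
    (n : ℕ) (K : Finset (Fin N)) (k : Fin N) (hK : K.card + 1 = n) (hk : k ∉ K) (p : P)
    (g : ∀ k, I k × O k) (m : Memory L I O Z) :
    (historyCircuit amp d M M').partialVector n K k p g m = arrival amp K k (g k).1 g p m := by
  induction n generalizing K k m with
  | zero => omega
  | succ n ih =>
    cases n with
    | zero =>
      obtain rfl : K = ∅ := Finset.card_eq_zero.1 (by omega)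
      -- The first operation is defined with the reference `d`, but before anyone has acted the
      -- amplitude does not depend on `g`.
      exact arrival_congr amp _ _ _ (by simp) _ _
    | succ n =>
      have hne : K.Nonempty := Finset.card_pos.1 (by omega)
      have hun : K ≠ Finset.univ := fun h => hk (h ▸ Finset.mem_univ k)
      have key := congrFun (hM K hne hun g p) ⟨k, (g k).1, m⟩
      simp only [received, hk, not_false_eq_true, if_true] at key
      rw [← key, ControlledCircuit.partialVector, mulVec, dotProduct, Fintype.sum_sigma,
        ← Finset.sum_subset (Finset.subset_univ K) fun l _ hl => Finset.sum_eq_zero fun x _ => by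
          simp [sent, hl]]
      refine Finset.sum_congr rfl fun l hl => ?_
      conv_rhs => rw [Fintype.sum_prod_type, Finset.sum_eq_single (g l).2
        (fun o _ ho => Finset.sum_eq_zero fun b _ => by simp [sent, ho]) (by simp)]
      refine Finset.sum_congr rfl fun b _ => ?_
      rw [ih (K.erase l) l (by rw [Finset.card_erase_add_one hl]; omega)
        (Finset.notMem_erase _ _)]
      simp [historyCircuit, sent, hl, Finset.insert_erase]

theorem processVector_historyCircuit
    (hM : ∀ S, S.Nonempty → S ≠ Finset.univ → ∀ g p, M S *ᵥ sent amp S g p = received amp S g p)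
    (hM' : ∀ g p, M' *ᵥ sent amp Finset.univ g p = finalSum amp g p)
    (g : ∀ k, I k × O k) (p : P) (z : Z) :
    (historyCircuit amp d M M').processVector (g, (p, z)) = finalSum amp g p z := by
  rw [← hM', ControlledCircuit.processVector, mulVec, dotProduct, Fintype.sum_sigma]
  refine Finset.sum_congr rfl fun l _ => ?_
  conv_rhs => rw [Fintype.sum_prod_type, Finset.sum_eq_single (g l).2
    (fun o _ ho => Finset.sum_eq_zero fun b _ => by simp [sent, ho]) (by simp)]
  refine Finset.sum_congr rfl fun b _ => ?_
  dsimp only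
  rw [partialVector_historyCircuit hM N _ _ (by
    rw [Finset.card_erase_add_one (Finset.mem_univ l), Finset.card_fin]) (Finset.notMem_erase _ _)]
  simp [sent]

/-- The state `sent`, with the control system. -/
def sentWithControl (amp : P → Messages L O → Z → Messages L I → ℂ) (n : ℕ) (S : Finset (Fin N))
    (g : ∀ k, I k × O k) (p : P) : (Σ c : Control N n, O c.1.2 × Memory L I O Z) → ℂ :=
  fun q => if S = insert q.1.1.2 q.1.1.1 then sent amp S g p ⟨q.1.1.2, q.2⟩ else 0

/-- The state `received`, with the control system. -/
def receivedWithControl (amp : P → Messages L O → Z → Messages L I → ℂ) (n : ℕ)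
    (S : Finset (Fin N)) (g : ∀ k, I k × O k) (p : P) :
    (Σ c : Control N n, I c.1.2 × Memory L I O Z) → ℂ :=
  fun q => if q.1.1.1 = S then received amp S g p ⟨q.1.1.2, q.2⟩ else 0

/-- The control system makes states with different sets `S` orthogonal, so the separately
constructed matrices `M S` combine into one isometric operation. -/
theorem gram_sentWithControl {n : ℕ} {S : Finset (Fin N)} (hS : S.card = n) (S' : Finset (Fin N))
    (g g' : ∀ k, I k × O k) (p p' : P) :
    star (sentWithControl amp n S g p) ⬝ᵥ sentWithControl amp n S' g' p' =
      if S = S' then star (sent amp S g p) ⬝ᵥ sent amp S g' p' else 0 := by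
  split_ifs with h
  · subst h
    simp only [dotProduct, Fintype.sum_sigma]
    rw [← sum_control_insert hS _ fun k hk => Finset.sum_eq_zero fun x _ => by simp [sent, hk]]
    refine Finset.sum_congr rfl fun c _ => ?_
    split_ifs with hc <;> simp [sentWithControl, hc]
  · refine Finset.sum_eq_zero fun q _ => ?_
    by_cases h1 : S = insert q.1.1.2 q.1.1.1
    · have : S' ≠ insert q.1.1.2 q.1.1.1 := fun h2 => h (h1.trans h2.symm)
      simp [sentWithControl, this]
    · simp [sentWithControl, h1]

theorem gram_receivedWithControl {n : ℕ} {S : Finset (Fin N)} (hS : S.card + 1 = n)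
    (S' : Finset (Fin N)) (g g' : ∀ k, I k × O k) (p p' : P) :
    star (receivedWithControl amp n S g p) ⬝ᵥ receivedWithControl amp n S' g' p' =
      if S = S' then star (received amp S g p) ⬝ᵥ received amp S g' p' else 0 := by
  split_ifs with h
  · subst h
    simp only [dotProduct, Fintype.sum_sigma]
    rw [← sum_control_eq hS _ fun k hk => Finset.sum_eq_zero fun x _ => by simp [received, hk]]
    refine Finset.sum_congr rfl fun c _ => ?_
    split_ifs with hc <;> simp [receivedWithControl, hc]
  · refine Finset.sum_eq_zero fun q _ => ?_
    by_cases h1 : q.1.1.1 = S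
    · have : q.1.1.1 ≠ S' := fun h2 => h (h1.symm.trans h2)
      simp [receivedWithControl, this]
    · simp [receivedWithControl, h1]

theorem VStep_mulVec_sentWithControl
    (hM : ∀ S, S.Nonempty → S ≠ Finset.univ → ∀ g p, M S *ᵥ sent amp S g p = received amp S g p)
    {n : ℕ} (hn : 1 ≤ n) (hnN : n < N) {S : Finset (Fin N)} (hS : S.card = n)
    (g : ∀ k, I k × O k) (p : P) :
    (historyCircuit amp d M M').VStep n *ᵥ sentWithControl amp n S g p =
      receivedWithControl amp (n + 1) S g p := by
  funext q
  have hne : S.Nonempty := Finset.card_pos.1 (by omega)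
  have hun : S ≠ Finset.univ := fun h => by
    rw [h, Finset.card_fin] at hS; omega
  have key := congrFun (hM S hne hun g p) ⟨q.1.1.2, q.2⟩
  simp only [receivedWithControl, ← key]
  simp only [mulVec, dotProduct]
  rw [Fintype.sum_sigma, Fintype.sum_sigma]
  by_cases hq : q.1.1.1 = S
  · rw [if_pos hq, ← sum_control_insert hS _ fun k hk => Finset.sum_eq_zero fun x _ => by
      simp [sent, hk]]
    refine Finset.sum_congr rfl fun c _ => ?_
    split_ifs with hc
    · refine Finset.sum_congr rfl fun x _ => ?_
      have : q.1.1.1 = insert c.1.2 c.1.1 := hq.trans hc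
      simp [ControlledCircuit.VStep, historyCircuit, this, sentWithControl, ← hc]
    · simp [sentWithControl, hc]
  · rw [if_neg hq]
    refine Finset.sum_eq_zero fun c _ => Finset.sum_eq_zero fun x _ => ?_
    by_cases hc : S = insert c.1.2 c.1.1
    · have : q.1.1.1 ≠ insert c.1.2 c.1.1 := fun h => hq (h.trans hc.symm)
      simp [ControlledCircuit.VStep, this]
    · simp [sentWithControl, hc]

theorem VLast_mulVec_sentWithControl
    (hM' : ∀ g p, M' *ᵥ sent amp Finset.univ g p = finalSum amp g p)
    (g : ∀ k, I k × O k) (p : P) :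
    (historyCircuit amp d M M').VLast *ᵥ sentWithControl amp N Finset.univ g p =
      finalSum amp g p := by
  funext z
  rw [← hM']
  simp only [mulVec, dotProduct]
  rw [Fintype.sum_sigma, Fintype.sum_sigma, ← sum_control_insert (Finset.card_fin N) _ fun k hk =>
    absurd (Finset.mem_univ k) hk]
  refine Finset.sum_congr rfl fun c _ => ?_
  split_ifs with hc
  · refine Finset.sum_congr rfl fun x _ => ?_
    simp [ControlledCircuit.VLast, historyCircuit, sentWithControl, ← hc]
  · simp [sentWithControl, hc]

/-! ### Expansion of the circuit states in matrix units, and isometry of the internal operations -/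

variable [∀ k, DecidableEq (I k)] [∀ k, DecidableEq (O k)]

theorem agents_mul_upTo_of_upTo (A : ∀ k, Matrix (O k) (I k) ℂ) (n : ℕ) (p : P)
    (h : ∀ (c : Control N n) (i : I c.1.2) (m : Memory L I O Z),
      (historyCircuit amp d M M').upTo A n ⟨c, i, m⟩ p =
        ∑ g, localWeight d A c.1.1 g * arrival amp c.1.1 c.1.2 i g p m) :
    (fun q => ((historyCircuit amp d M M').agents A n *
      (historyCircuit amp d M M').upTo A n) q p) =
    ∑ S : Finset (Fin N) with S.card = n, ∑ g, localWeight d A S g •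
      sentWithControl amp n S g p := by
  funext ⟨c, o, m⟩
  have hupd : ∀ (i : I c.1.2) (g : ∀ k, I k × O k) (x : I c.1.2 × O c.1.2),
      arrival amp c.1.1 c.1.2 i (Function.update g c.1.2 x) p m =
        arrival amp c.1.1 c.1.2 i g p m := by
    intro i g x
    refine arrival_congr amp _ _ _ (fun j hj => ?_) _ _
    have hjc : j ≠ c.1.2 := fun e => c.2.2 (e ▸ hj)
    simp [hjc]
  rw [ControlledCircuit.agents_mul_apply]
  simp only [h]
  rw [← sum_localWeight_insert d A c.2.2 (fun i g => arrival amp c.1.1 c.1.2 i g p m) hupd]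
  rw [Finset.sum_apply, Finset.sum_eq_single (insert c.1.2 c.1.1)]
  · simp [sentWithControl, sent, Finset.erase_insert c.2.2]
  · intro S _ hS
    simp [sentWithControl, hS]
  · intro hS
    exact absurd (by simp [Finset.card_insert_of_notMem c.2.2, c.2.1]) hS

theorem upTo_historyCircuit
    (hM : ∀ S, S.Nonempty → S ≠ Finset.univ → ∀ g p, M S *ᵥ sent amp S g p = received amp S g p)
    (A : ∀ k, Matrix (O k) (I k) ℂ) (n : ℕ) (hn : n + 1 ≤ N) (p : P)
    (c : Control N (n + 1)) (i : I c.1.2) (m : Memory L I O Z) :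
    (historyCircuit amp d M M').upTo A (n + 1) ⟨c, i, m⟩ p =
      ∑ g, localWeight d A c.1.1 g * arrival amp c.1.1 c.1.2 i g p m := by
  induction n generalizing m with
  | zero =>
    have hc : c.1.1 = ∅ := Finset.card_eq_zero.1 (by have := c.2.1; omega)
    simp only [hc, localWeight_empty]
    simp [ControlledCircuit.upTo, ControlledCircuit.VFirst]
  | succ n ih =>
    have key := agents_mul_upTo_of_upTo A (n + 1) p fun c i m => ih (by omega) c i m
    have h1 : (historyCircuit amp d M M').upTo A (n + 1 + 1) ⟨c, i, m⟩ p =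
        ((historyCircuit amp d M M').VStep (n + 1) *ᵥ (fun q =>
          ((historyCircuit amp d M M').agents A (n + 1) *
            (historyCircuit amp d M M').upTo A (n + 1)) q p)) ⟨c, i, m⟩ := rfl
    rw [h1, key]
    simp only [mulVec_sum, mulVec_smul, Finset.sum_apply, Pi.smul_apply, smul_eq_mul]
    rw [Finset.sum_eq_single c.1.1]
    · refine Finset.sum_congr rfl fun g _ => ?_
      rw [VStep_mulVec_sentWithControl hM (by omega) (by omega)
        (by have := c.2.1; omega)]
      simp [receivedWithControl, received, c.2.2]
    · intro S hS hSc
      refine Finset.sum_eq_zero fun g _ => ?_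
      rw [VStep_mulVec_sentWithControl hM (by omega) (by omega) (Finset.mem_filter.1 hS).2]
      simp [receivedWithControl, Ne.symm hSc]
    · intro hS
      exact absurd (by have := c.2.1; simp; omega) hS

/-- Arbitrary local operators are combinations of matrix units, so isometry need only be checked on
the vectors `sentWithControl`, whose Gram matrices are known. -/
theorem effectiveSpace_historyCircuit_le [Fintype P]
    (hM : ∀ S, S.Nonempty → S ≠ Finset.univ → ∀ g p, M S *ᵥ sent amp S g p = received amp S g p)
    (n : ℕ) (hn : 1 ≤ n) (hnN : n ≤ N) :
    (historyCircuit amp d M M').effectiveSpace n ≤ Submodule.span ℂ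
      {u | ∃ S g p, S.card = n ∧ u = sentWithControl amp n S g p} := by
  obtain ⟨n, rfl⟩ : ∃ n', n = n' + 1 := ⟨n - 1, by omega⟩
  refine Submodule.span_le.2 ?_
  rintro _ ⟨A, ψ, rfl⟩
  have h1 : ((historyCircuit amp d M M').agents A (n + 1) *
      (historyCircuit amp d M M').upTo A (n + 1)) *ᵥ ψ = ∑ p, ψ p • fun q =>
        ((historyCircuit amp d M M').agents A (n + 1) *
          (historyCircuit amp d M M').upTo A (n + 1)) q p := by
    funext q
    simp [mulVec, dotProduct, mul_comm]
  rw [h1]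
  refine Submodule.sum_mem _ fun p _ => Submodule.smul_mem _ _ ?_
  rw [agents_mul_upTo_of_upTo A (n + 1) p fun c i m => upTo_historyCircuit hM A n hnN p c i m]
  exact Submodule.sum_mem _ fun S hS => Submodule.sum_mem _ fun g _ => Submodule.smul_mem _ _
    (Submodule.subset_span ⟨S, g, p, (Finset.mem_filter.1 hS).2, rfl⟩)

theorem isQCQC_historyCircuit [Fintype P] [DecidableEq P] [∀ k, Nonempty (O k)]
    (h : IsCausalAmplitude amp) (hN : 0 < N)
    (hM : ∀ S, S.Nonempty → S ≠ Finset.univ → ∀ g p, M S *ᵥ sent amp S g p = received amp S g p)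
    (hM' : ∀ g p, M' *ᵥ sent amp Finset.univ g p = finalSum amp g p) :
    (historyCircuit amp d M M').IsQCQC where
  first_isometry := by
    ext p p'
    have key := gram_receivedWithControl (amp := amp) (n := 1) (S := ∅) (by simp) ∅ d d p p'
    rw [if_pos rfl, gram_received_empty h hN] at key
    have h1 : ∀ p, (fun q => (historyCircuit amp d M M').VFirst q p) =
        receivedWithControl amp 1 ∅ d p := by
      intro p
      funext q
      have hc : q.1.1.1 = ∅ := Finset.card_eq_zero.1 (by have := q.1.2.1; omega)
      simp [receivedWithControl, received, hc, ControlledCircuit.VFirst]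
    rw [one_apply, mul_apply]
    rw [← h1, ← h1] at key
    exact key.trans (by split_ifs <;> rfl)
  step_isometry n hn hnN u hu v hv := by
    refine dotProduct_mulVec_of_mem_span _ _ ?_ (effectiveSpace_historyCircuit_le hM n hn hnN.le hu)
      (effectiveSpace_historyCircuit_le hM n hn hnN.le hv)
    rintro _ ⟨S, g, p, hS, rfl⟩ _ ⟨S', g', p', hS', rfl⟩
    rw [VStep_mulVec_sentWithControl hM hn hnN hS, VStep_mulVec_sentWithControl hM hn hnN hS',
      gram_receivedWithControl (by rw [hS]), gram_sentWithControl hS,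
      gram_sent_eq_gram_received h (Finset.card_pos.1 (by omega))
        (fun h => by rw [h, Finset.card_fin] at hS; omega)]
  last_isometry u hu v hv := by
    refine dotProduct_mulVec_of_mem_span _ _ ?_ (effectiveSpace_historyCircuit_le hM N hN le_rfl hu)
      (effectiveSpace_historyCircuit_le hM N hN le_rfl hv)
    rintro _ ⟨S, g, p, hS, rfl⟩ _ ⟨S', g', p', hS', rfl⟩
    obtain rfl := (Finset.card_eq_iff_eq_univ S).1 (by rw [hS, Fintype.card_fin])
    obtain rfl := (Finset.card_eq_iff_eq_univ S').1 (by rw [hS', Fintype.card_fin])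
    rw [VLast_mulVec_sentWithControl hM', VLast_mulVec_sentWithControl hM',
      gram_sentWithControl hS, if_pos rfl, gram_sent_univ h hN]

end Circuit

/-! ### Partial traces of matrix units -/

open Classical in
-- Tracing out kills a matrix unit unless row and column agree on the discarded factors; otherwise
-- the matrix unit of the retained factors is left.
theorem ptrace_single_apply {σ : Type} [Fintype σ] {B : σ → Type} [∀ s, Fintype (B s)]
    [DecidableEq (∀ s, B s)]
    (q : σ → Prop) (a b : ∀ s, B s) (α β : ∀ s : {s // q s}, B s) :
    ptrace q (single a b 1) α β =
      if (∀ s, α s = a s ∧ β s = b s) ∧ ∀ s, ¬ q s → a s = b s then 1 else 0 := by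
  have hiff : ∀ (α : ∀ s : {s // q s}, B s) (c : ∀ s : {s // ¬ q s}, B s) (a : ∀ s, B s),
      a = (Equiv.piEquivPiSubtypeProd q B).symm (α, c) ↔ (∀ s, α s = a s) ∧ ∀ s, c s = a s := by
    intro α c a
    rw [← Equiv.symm_apply_eq, Equiv.symm_symm, Prod.ext_iff, funext_iff, funext_iff]
    simp only [Equiv.piEquivPiSubtypeProd_apply, eq_comm]
  simp only [ptrace, of_apply, single_apply, hiff]
  split_ifs with h
  · rw [Finset.sum_eq_single (fun s : {s // ¬ q s} => a s)]
    · rw [if_pos]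
      exact ⟨⟨fun s => (h.1 s).1, fun _ => rfl⟩, fun s => (h.1 s).2, fun s => h.2 s s.2⟩
    · intro c _ hc
      exact if_neg fun hh => hc (funext hh.1.2)
    · simp
  · refine Finset.sum_eq_zero fun c _ => if_neg fun hh => h ?_
    exact ⟨fun s => ⟨hh.1.1 s, hh.2.1 s⟩, fun s hs => (hh.1.2 ⟨s, hs⟩).symm.trans (hh.2.2 ⟨s, hs⟩)⟩

theorem ptrace_single_eq_zero {σ : Type} [Fintype σ] {B : σ → Type} [∀ s, Fintype (B s)]
    [DecidableEq (∀ s, B s)] {q : σ → Prop} {a b : ∀ s, B s} (h : ¬ ∀ s, ¬ q s → a s = b s) :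
    ptrace q (single a b (1 : ℂ)) = 0 := by
  ext α β
  rw [ptrace_single_apply, if_neg fun hh => h hh.2, Matrix.zero_apply]

theorem ptrace_single_congr {σ : Type} [Fintype σ] {B : σ → Type} [∀ s, Fintype (B s)]
    [DecidableEq (∀ s, B s)] {q : σ → Prop} {a b a' b' : ∀ s, B s} (ha : ∀ s, q s → a s = a' s)
    (hb : ∀ s, q s → b s = b' s)
    (h : (∀ s, ¬ q s → a s = b s) ↔ ∀ s, ¬ q s → a' s = b' s) :
    ptrace q (single a b (1 : ℂ)) = ptrace q (single a' b' 1) := by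
  classical
  ext α β
  rw [ptrace_single_apply, ptrace_single_apply]
  refine if_congr (and_congr (forall_congr' fun s => ?_) h) rfl rfl
  rw [ha s s.2, hb s s.2]

/-! ### Partial traces in terms of message patterns -/

section Wires

variable {N L : ℕ} {A : Fin N → Type} {D : Type}

/-- The basis states of a wire are those of the global past (future) and the agents. -/
def wireEquiv : D × Messages L A ≃ WireBasis L A D where
  toFun q := wireState q.1 q.2
  invFun η := (η none, fun k r => η (some (r, k)))
  left_inv _ := rfl
  right_inv η := by
    funext s
    cases s <;> rfl

open Classical in
theorem ptrace_wireState [∀ k, Fintype (A k)] [Fintype D] {q : Slot N L → Prop} {t : ℕ}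
    (h0 : ¬ q none) (hq : ∀ r k, q (some (r, k)) ↔ r.val < t)
    (M : Matrix (WireBasis L A D) (WireBasis L A D) ℂ) (d : D) (y y' : Messages L A) :
    ptrace q M (fun s => wireState d y s) (fun s => wireState d y' s) =
      ∑ c with VacantBefore t c, ∑ f, M (wireState f (splice t y c)) (wireState f (splice t y' c)) := by
  have hs : ∀ (y c : Messages L A) (f : D) (c' : ∀ s : {s // ¬ q s}, SlotBasis L A D s),
      (∀ s, c' s = wireState f c s) →
      (Equiv.piEquivPiSubtypeProd q (SlotBasis L A D)).symm (fun s => wireState d y s, c') =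
        wireState f (splice t y c) := by
    intro y c f c' hc'
    funext s
    rcases s with _ | ⟨r, k⟩
    · simp [Equiv.piEquivPiSubtypeProd, h0, hc', wireState]
      rfl
    · by_cases hr : r.val < t
      · have : q (some (r, k)) := (hq r k).2 hr
        simp [Equiv.piEquivPiSubtypeProd, this, wireState, splice, hr]
        rfl
      · have : ¬ q (some (r, k)) := fun h => hr ((hq r k).1 h)
        simp [Equiv.piEquivPiSubtypeProd, this, hc', wireState, splice, hr]
        rfl
  unfold ptrace
  rw [of_apply, ← Finset.sum_product']
  refine (Finset.sum_bij (fun (w : Messages L A × D) _ => fun s : {s // ¬ q s} =>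
    wireState w.2 w.1 s) (by simp) ?_ ?_ ?_).symm
  · rintro ⟨c, f⟩ hc ⟨c', f'⟩ hc' he
    simp only [Finset.mem_product, Finset.mem_filter, Finset.mem_univ, true_and, and_true]
      at hc hc'
    have hf : f = f' := congrFun he ⟨none, h0⟩
    have hcc : c = c' := by
      funext k r
      by_cases hr : r.val < t
      · rw [hc k r hr, hc' k r hr]
      · exact congrFun he ⟨some (r, k), fun h => hr ((hq r k).1 h)⟩
    rw [hf, hcc]
  · intro c' _
    refine ⟨(fun k r => if hr : r.val < t then none else
      c' ⟨some (r, k), fun h => hr ((hq r k).1 h)⟩, c' ⟨none, h0⟩), ?_, ?_⟩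
    · simp only [Finset.mem_product, Finset.mem_filter, Finset.mem_univ, true_and]
      exact ⟨fun k r hr => dif_pos hr, Finset.mem_univ _⟩
    · funext ⟨s, hs⟩
      rcases s with _ | ⟨r, k⟩
      · rfl
      · exact dif_neg fun hr => hs ((hq r k).2 hr)
  · rintro ⟨c, f⟩ _
    rw [hs y c f _ fun _ => rfl, hs y' c f _ fun _ => rfl]

end Wires

/-! ### The amplitudes of a purified process box -/

section Purification

variable {N L : ℕ} {I O : Fin N → Type} {P F E : Type}
  [∀ k, Fintype (I k)] [∀ k, Fintype (O k)] [Fintype P] [Fintype F] [Fintype E]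
  [∀ k, DecidableEq (I k)] [∀ k, DecidableEq (O k)] [DecidableEq P] [DecidableEq F]

/-- The matrix elements of `V`, by the states of the global past and future and the messages. -/
def amplitude (V : Matrix (WireBasis L I F × E) (WireBasis L O P) ℂ) (p : P) (x : Messages L O)
    (z : F × E) (y : Messages L I) : ℂ :=
  V (wireState z.1 y, z.2) (wireState p x)

variable {Φ : ProcessBox N L I O P F} {V : Matrix (WireBasis L I F × E) (WireBasis L O P) ℂ}

theorem ProcessBox.IsPurification.map_single_apply (hV : Φ.IsPurification V)
    (a b : WireBasis L O P) (η η' : WireBasis L I F) :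
    Φ.map (single a b 1) η η' = ∑ e, V (η, e) a * conj (V (η', e) b) := by
  rw [hV.dilates]
  refine Finset.sum_congr rfl fun e _ => ?_
  rw [mul_mul_conjTranspose_apply, Finset.sum_eq_single a, Finset.sum_eq_single b]
  · simp
  · intro j _ hj
    simp [Ne.symm hj]
  · simp
  · intro i _ hi
    simp [Ne.symm hi]
  · simp

/-- The cut up to the inputs of the agents in round `t`. -/
def roundCut {L : ℕ} (t : Fin L) : LowerSet (Position L) :=
  LowerSet.Iic ⟨2 * t + 2, by have := t.isLt; omega⟩

/-- Since `χ C ⊆ C`, an answer in `χ (roundCut t)` has odd position `2r + 3 ≤ 2t + 2`, so it belongs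
to a round strictly before `t`. -/
theorem lt_of_posIn_mem_causality (Φ : ProcessBox N L I O P F) (t : Fin L) {r : Fin L} {k : Fin N}
    (h : posIn N L (some (r, k)) ∈ Φ.χ (roundCut t)) : r < t := by
  have hlt := Φ.causality.strict (roundCut t) ⟨_, fun s hs => hs⟩
    (fun h => by
      have : (⟨2 * t + 2, by have := t.isLt; omega⟩ : Position L) ∈ roundCut t :=
        LowerSet.mem_Iic_iff.2 le_rfl
      rw [h] at this
      exact this)
  have h1 : posIn N L (some (r, k)) ≤ ⟨2 * t + 2, by have := t.isLt; omega⟩ := hlt.le h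
  have h2 : 2 * r.val + 3 ≤ 2 * t.val + 2 := h1
  exact Fin.lt_def.2 (by omega)

open Classical in
theorem sum_amplitude_eq_part (hV : Φ.IsPurification V) (t : Fin L) (f : F) (p p' : P)
    (x x' : Messages L O) (y y' : Messages L I) :
    ∑ c with VacantBefore (t + 1) c, ∑ z,
      conj (amplitude V p x z (splice (t + 1) y c)) * amplitude V p' x' z (splice (t + 1) y' c) =
    Φ.part (roundCut t) (ptrace (fun s => posIn N L s ∈ Φ.χ (roundCut t))
      (single (wireState p' x') (wireState p x) 1))
      (fun s => wireState f y' s) (fun s => wireState f y s) := by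
  rw [← Φ.ptrace_map, ptrace_wireState (t := t + 1)]
  · refine Finset.sum_congr rfl fun c _ => ?_
    rw [Fintype.sum_prod_type]
    refine Finset.sum_congr rfl fun f _ => ?_
    rw [hV.map_single_apply]
    exact Finset.sum_congr rfl fun e _ => mul_comm _ _
  · intro h
    have h2 : 2 * L + 2 ≤ 2 * t.val + 2 := h
    have := t.isLt
    omega
  · intro r k
    have : posOut N L (some (r, k)) ∈ roundCut t ↔ 2 * r.val + 2 ≤ 2 * t.val + 2 := Iff.rfl
    rw [this]
    omega

theorem ProcessBox.IsPurification.isCausalAmplitude [∀ k, Nonempty (O k)]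
    (hV : Φ.IsPurification V) : IsCausalAmplitude (amplitude V) where
  norm p p' := by
    have h := congrFun (congrFun hV.isometry (wireState p vacuum)) (wireState p' vacuum)
    rw [mul_apply, Fintype.sum_prod_type, ← wireEquiv.sum_comp, Fintype.sum_prod_type,
      Finset.sum_comm] at h
    simp only [Fintype.sum_prod_type]
    refine (Eq.trans ?_ h).trans ?_
    · rfl
    · rw [one_apply]
      have : (wireState p vacuum : WireBasis L O P) = wireState p' vacuum ↔ p = p' :=
        ⟨fun h => congrFun h none, fun h => by rw [h]⟩
      simp only [this]
      split_ifs <;> rfl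
  causal_zero t ht p p' x x' y y' hx := by
    cases isEmpty_or_nonempty F with
    | inl hF => simp
    | inr hF =>
      obtain ⟨f⟩ := hF
      rw [sum_amplitude_eq_part hV ⟨t, ht⟩ f]
      rw [ptrace_single_eq_zero (B := SlotBasis L O P), map_zero, Matrix.zero_apply]
      intro h
      refine hx fun k r hr => ?_
      exact (h (some (r, k)) fun hm => absurd (Fin.lt_def.1 (lt_of_posIn_mem_causality Φ _ hm))
        (not_lt.2 hr)).symm
  causal_congr t ht p p' x x' w w' y y' hx hw hxw hxw' := by
    cases isEmpty_or_nonempty F with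
    | inl hF => simp
    | inr hF =>
      obtain ⟨f⟩ := hF
      rw [sum_amplitude_eq_part hV ⟨t, ht⟩ f, sum_amplitude_eq_part hV ⟨t, ht⟩ f]
      have hs : ∀ (p : P) {x w : Messages L O}, AgreeBefore t x w → ∀ s : Slot N L,
          posIn N L s ∈ Φ.χ (roundCut ⟨t, ht⟩) →
          (wireState p x s : SlotBasis L O P s) = wireState p w s := by
        intro p x w h s hm
        rcases s with _ | ⟨r, k⟩
        · rfl
        · exact h k r (Fin.lt_def.1 (lt_of_posIn_mem_causality Φ _ hm))
      have hd : (∀ s : Slot N L, posIn N L s ∉ Φ.χ (roundCut ⟨t, ht⟩) →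
          (wireState p' x' s : SlotBasis L O P s) = wireState p x s) ↔
          ∀ s : Slot N L, posIn N L s ∉ Φ.χ (roundCut ⟨t, ht⟩) →
          (wireState p' w' s : SlotBasis L O P s) = wireState p w s := by
        refine forall_congr' fun s => imp_congr_right fun hm => ?_
        rcases s with _ | ⟨r, k⟩
        · rfl
        · change x' k r = x k r ↔ w' k r = w k r
          by_cases hr : r.val < t
          · rw [hxw k r hr, hxw' k r hr]
          · rw [hx k r (not_lt.1 hr), hw k r (not_lt.1 hr)]
            simp
      rw [ptrace_single_congr (B := SlotBasis L O P) (hs p' hxw') (hs p hxw) hd]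
  active p x z y hm hy := by
    classical
    obtain ⟨f, e⟩ := z
    -- Full activity is tested on agents that answer any message in round `t` with `o k t`, the
    -- message prescribed by `x`, and keep the received message as result. The result `y` then
    -- selects precisely the outputs `x` and inputs `y`, and its probability is a sum of squared
    -- moduli containing that of the given amplitude.
    let o : ∀ k, Fin L → O k := fun k t => (x k t).getD (Classical.arbitrary _)
    let reply : ∀ k, Fin L → Option (I k) → Option (O k) × Option (I k) :=
      fun k t i => (i.map fun _ => o k t, i)
    let B : ∀ k, LocalOperation L (I k) (O k) (I k) := fun k =>
      { op := fun t => Matrix.of fun q i => if q = reply k t i then 1 else 0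
        isometry := fun t => by
          ext i j
          rw [mul_apply, one_apply]
          simp only [conjTranspose_apply, of_apply]
          rw [Finset.sum_eq_single (reply k t i)]
          · have : reply k t i = reply k t j ↔ i = j :=
              ⟨fun h => congrArg Prod.snd h, fun h => by rw [h]⟩
            simp [this]
          · intro q _ hq
            simp [hq]
          · simp
        local_order := fun t q => by simp [reply]
        active := fun t i q hq => by
          rw [of_apply, if_neg]
          rintro rfl
          simp [reply] at hq }
    have hjoint : ∀ x' y', jointOp B y x' y' = if x' = x ∧ y' = y then 1 else 0 := by
      intro x' y'
      have h1 : ∀ k t, (B k).op t (x' k t, y k t) (y' k t) =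
          if x' k t = x k t ∧ y' k t = y k t then 1 else 0 := by
        intro k t
        have : (x' k t, y k t) = reply k t (y' k t) ↔ x' k t = x k t ∧ y' k t = y k t := by
          simp only [reply, Prod.mk.injEq]
          have h2 : (y k t).map (fun _ => o k t) = x k t := by
            have h3 := hm k t t.isLt
            cases hyk : y k t with
            | none => simpa [hyk, eq_comm] using h3.2 hyk
            | some i =>
              obtain ⟨v, hv⟩ := Option.ne_none_iff_exists'.1
                (fun h => by simp [hyk] at h3; exact h3 h)
              simp [o, hv]
          constructor
          · rintro ⟨h4, h5⟩
            exact ⟨by rw [h4, ← h5, h2], h5.symm⟩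
          · rintro ⟨h4, h5⟩
            rw [h5, h2]
            exact ⟨h4, rfl⟩
        change (if _ then _ else _) = _
        simp only [this]
      simp only [jointOp, h1, Finset.prod_ite_zero, Finset.prod_const_one, Finset.mem_univ,
        true_implies, funext_iff, forall_and]
    have hρ : (single p p (1 : ℂ)).PosSemidef := by
      have h1 : single p p (1 : ℂ) = vecMulVec (Pi.single p 1) (star (Pi.single p 1)) := by
        ext i j
        simp only [single_apply, vecMulVec_apply, Pi.star_apply, Pi.single_apply, eq_comm (a := p)]
        by_cases hi : i = p <;> by_cases hj : j = p <;> simp [hi, hj]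
      rw [h1]
      exact posSemidef_vecMulVec_self_star _
    have key := Φ.fullyActive I B (single p p 1) hρ (by simp) y hy
    unfold resultProb at key
    rw [Finset.sum_eq_single x, Finset.sum_eq_single x, Finset.sum_eq_single y,
      Finset.sum_eq_single y] at key
    · have hpast : pastTensor (single p p 1) x x =
          single (wireState p x : WireBasis L O P) (wireState p x) (1 : ℂ) := by
        ext a b
        have hw : ∀ a : WireBasis L O P, wireState p x = a ↔ (∀ k t, a (some (t, k)) = x k t) ∧
            p = a none := by
          intro a
          constructor
          · rintro rfl
            exact ⟨fun _ _ => rfl, rfl⟩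
          · rintro ⟨h1, h2⟩
            funext s
            rcases s with _ | ⟨t, k⟩
            · exact h2
            · exact (h1 k t).symm
        have hs : single p p (1 : ℂ) (a none) (b none) =
            if p = a none ∧ p = b none then 1 else 0 := by
          by_cases h : p = a none ∧ p = b none
          · rw [if_pos h]; exact if_pos h
          · rw [if_neg h]; exact if_neg h
        simp only [pastTensor, of_apply, hs]
        simp only [single_apply, hw]
        split_ifs <;> first | rfl | (exfalso; tauto)
      rw [hjoint, if_pos ⟨rfl, rfl⟩, map_one, one_mul, one_mul, hpast] at key
      simp only [hV.map_single_apply] at key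
      have hnn : ∀ a : ℂ, 0 ≤ a * conj a := fun a => mul_star_self_nonneg a
      rw [Finset.sum_eq_zero_iff_of_nonneg fun f _ => Finset.sum_nonneg fun e _ => hnn _] at key
      have key2 := key f (Finset.mem_univ f)
      rw [Finset.sum_eq_zero_iff_of_nonneg fun e _ => hnn _] at key2
      have key3 := key2 e (Finset.mem_univ e)
      simpa [amplitude] using key3
    all_goals first
      | exact fun h => absurd (Finset.mem_univ _) h
      | exact fun w _ hw => by simp [hjoint, hw]

end Purification

/-! ### Operational equivalence -/

/-- Without states of the global past, there is nothing to describe. -/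
theorem exists_circuit_of_isEmpty {N L : ℕ} {I O : Fin N → Type} {P F E : Type}
    [∀ k, Fintype (I k)] [∀ k, Fintype (O k)] [Fintype P] [Fintype F] [Fintype E]
    [DecidableEq P] [DecidableEq F] [DecidableEq E] [IsEmpty P]
    (V : Matrix (WireBasis L I F × E) (WireBasis L O P) ℂ) :
    ∃ Q : ControlledCircuit N I O P (F × E), Q.IsQCQC ∧ OperationallyEquivalent Q V := by
  let Q : ControlledCircuit N I O P (F × E) :=
    { α := fun _ => Unit, first := fun _ => 0, step := fun _ _ _ _ => 0, last := fun _ => 0 }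
  have hQ : ∀ n, ∀ u ∈ Q.effectiveSpace n, u = 0 := by
    intro n u hu
    have : Q.effectiveSpace n ≤ ⊥ := by
      refine Submodule.span_le.2 ?_
      rintro _ ⟨A, ψ, rfl⟩
      rw [Subsingleton.elim ψ 0, mulVec_zero]
      exact Submodule.zero_mem _
    exact (Submodule.mem_bot ℂ).1 (this hu)
  refine ⟨Q, ⟨Subsingleton.elim _ _, fun n _ _ u hu v hv => ?_, fun u hu v hv => ?_⟩, 1, 1,
    by simp, by simp, fun A => ?_⟩
  · rw [hQ n u hu]; simp
  · rw [hQ N u hu]; simp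
  · funext q
    exact isEmptyElim q.1

section Equivalence

variable {N L : ℕ} {I O : Fin N → Type}

/-- An agent that cannot receive any message contradicts full activity: all amplitudes would vanish,
although `V` preserves the norm of `p`. This supplies the reference `d`. -/
theorem IsCausalAmplitude.nonempty_input {P Z : Type} [∀ k, Fintype (I k)] [Fintype Z]
    [∀ k, Nonempty (O k)] {amp : P → Messages L O → Z → Messages L I → ℂ}
    (h : IsCausalAmplitude amp) (p : P) (k : Fin N) : Nonempty (I k) := by
  by_contra hI
  rw [not_nonempty_iff] at hI
  have hy : ∀ y : Messages L I, ¬ ExactlyOnce y := fun y he => by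
    obtain ⟨r, hr, -⟩ := he k
    exact hr (Subsingleton.elim _ _)
  have h0 : ∀ x z y, amp p x z y = 0 := by
    intro x z y
    -- `eq_zero` needs a round to start from; without rounds every pattern is matched.
    rcases Nat.eq_zero_or_pos L with hL | hL
    · exact h.active p x z y (fun k r _ => absurd r.isLt (by omega)) (hy y)
    · exact h.eq_zero 0 hL p x z y (fun k r hr => absurd hr (by omega)) fun y' _ => hy y'
  have := h.norm p p
  simp [h0] at this

/-- The messages to and from the agents in the history `τ`. -/
def exchanges (g : ∀ k, I k × O k) (τ : Fin N → Option (Fin L)) :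
    ∀ k, Fin L → Option (I k) × Option (O k) :=
  fun k r => (inputs τ g k r, outputs τ g k r)

theorem isEffective_exchanges {g : ∀ k, I k × O k} {τ : Fin N → Option (Fin L)}
    (hτ : τ ∈ histories L Finset.univ L) (k : Fin N) : IsEffective (exchanges g τ k) := by
  obtain ⟨t, ht⟩ := Option.ne_none_iff_exists'.1 (((mem_histories.1 hτ).1 k).2 (Finset.mem_univ k))
  refine ⟨t, fun s hs => ?_, fun h => ?_⟩
  · have : τ k ≠ some s := fun h => hs (Option.some.inj (h.symm.trans ht))
    simp [exchanges, ofHistory_of_ne this]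
  · simp [exchanges, ofHistory_of_eq ht] at h

theorem equivalentChoiTensor_exchanges (A : ∀ k, Matrix (O k) (I k) ℂ) {g : ∀ k, I k × O k}
    {τ : Fin N → Option (Fin L)} (hτ : τ ∈ histories L Finset.univ L) :
    equivalentChoiTensor L A (exchanges g τ) = choiTensor A g := by
  refine Finset.prod_congr rfl fun k _ => ?_
  obtain ⟨t, ht⟩ := Option.ne_none_iff_exists'.1 (((mem_histories.1 hτ).1 k).2 (Finset.mem_univ k))
  rw [equivalentOp, of_apply, Finset.prod_eq_single t]
  · simp [exchanges, ofHistory_of_eq ht, withVacuum]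
  · intro s _ hs
    have : τ k ≠ some s := fun h => hs (Option.some.inj (h.symm.trans ht))
    simp [exchanges, ofHistory_of_ne this, withVacuum]
  · simp

variable {P F E : Type} [∀ k, Fintype (I k)] [∀ k, Fintype (O k)] [Fintype F] [Fintype E]

/-- The operations `A ⊕ |Ω⟩⟨Ω|` vanish unless answers match messages, and then full activity leaves
only patterns with exactly one message per agent. Such a pattern is the same as a history `τ` of all
agents with contents `g`. -/
theorem link_equivalentChoiTensor {V : Matrix (WireBasis L I F × E) (WireBasis L O P) ℂ}
    (hV : IsCausalAmplitude (amplitude V)) (A : ∀ k, Matrix (O k) (I k) ℂ) (p : P) (z : F × E) :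
    link (equivalentChoiTensor L A) (effectiveChoi V) (p, z) =
      ∑ g, choiTensor A g * finalSum (amplitude V) g p z := by
  classical
  simp only [finalSum, Finset.mul_sum, link]
  rw [← Finset.sum_product']
  symm
  refine Finset.sum_of_injOn (fun q => exchanges q.1 q.2) ?_
    (fun _ _ => Finset.mem_coe.2 (Finset.mem_univ _)) ?_ ?_
  · rintro ⟨g, τ⟩ hq ⟨g', τ'⟩ hq' he
    simp only [Finset.coe_product, Set.mem_prod, Finset.mem_coe, Finset.mem_univ, true_and]
      at hq hq'
    have hk : ∀ k, τ k = τ' k ∧ g k = g' k := by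
      intro k
      obtain ⟨t, ht⟩ := Option.ne_none_iff_exists'.1
        (((mem_histories.1 hq).1 k).2 (Finset.mem_univ k))
      have h1 := congrFun (congrFun he k) t
      simp only [exchanges, ofHistory_of_eq ht, Prod.mk.injEq] at h1
      have ht' : τ' k = some t := by
        by_contra h
        simp [ofHistory_of_ne h] at h1
      simp only [ofHistory_of_eq ht'] at h1
      exact ⟨ht.trans ht'.symm, Prod.ext (Option.some.inj h1.1) (Option.some.inj h1.2)⟩
    exact Prod.ext (funext fun k => (hk k).2) (funext fun k => (hk k).1)
  · intro h _ hh
    by_contra hne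
    refine hh ?_
    have hA := left_ne_zero_of_mul hne
    have hE := right_ne_zero_of_mul hne
    have hm : ∀ k t, (h k t).2 = none ↔ (h k t).1 = none := by
      intro k t
      have h0 := Finset.prod_ne_zero_iff.1 hA k (Finset.mem_univ k)
      rw [equivalentOp, of_apply] at h0
      have h1 := Finset.prod_ne_zero_iff.1 h0 t (Finset.mem_univ t)
      rcases h2 : h k t with ⟨_ | i, _ | o⟩ <;> simp [h2, withVacuum] at h1 ⊢
    have he : ExactlyOnce (A := I) fun k t => (h k t).1 := by
      by_contra hno
      refine hE ?_
      rw [effectiveChoi]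
      split_ifs
      · exact hV.active p (fun k t => (h k t).2) z (fun k t => (h k t).1)
          (fun k t _ => hm k t) hno
      · rfl
    choose r hr hr' using he
    have hi : ∀ k, ∃ x : I k × O k, h k (r k) = (some x.1, some x.2) := by
      intro k
      obtain ⟨i, hi⟩ := Option.ne_none_iff_exists'.1 (hr k)
      obtain ⟨o, ho⟩ := Option.ne_none_iff_exists'.1 (mt (hm k (r k)).1 (hr k))
      exact ⟨(i, o), Prod.ext hi ho⟩
    choose g hg using hi
    refine ⟨(g, fun k => some (r k)), ?_, ?_⟩
    · simp [mem_histories]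
    · funext k t
      by_cases ht : r k = t
      · subst ht
        simp [exchanges, ofHistory, hg]
      · have h1 : (h k t).1 = none := by
          by_contra h2
          exact ht (hr' k t h2).symm
        have h2 := (hm k t).2 h1
        simp only [exchanges, ofHistory, Option.some.injEq, ht, if_false]
        exact (Prod.ext h1 h2).symm
  · rintro ⟨g, τ⟩ hq
    have hτ : τ ∈ histories L Finset.univ L := (Finset.mem_product.1 hq).2
    rw [equivalentChoiTensor_exchanges A hτ, effectiveChoi, if_pos fun k =>
      isEffective_exchanges hτ k]
    rfl

theorem ProcessBox.IsPurification.exists_circuit [Fintype P] [∀ k, DecidableEq (I k)]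
    [∀ k, DecidableEq (O k)] [DecidableEq P] [DecidableEq F] [DecidableEq E]
    [∀ k, Nonempty (O k)] (hN : 0 < N)
    {Φ : ProcessBox N L I O P F} {V : Matrix (WireBasis L I F × E) (WireBasis L O P) ℂ}
    (hV : Φ.IsPurification V) :
    ∃ Q : ControlledCircuit N I O P (F × E), Q.IsQCQC ∧ OperationallyEquivalent Q V := by
  -- A state of the past is needed to show that the input spaces are nonzero, hence that a reference
  -- `d` exists.
  cases isEmpty_or_nonempty P with
  | inl hP => exact exists_circuit_of_isEmpty V
  | inr hP =>
    have h := hV.isCausalAmplitude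
    have hI : ∀ k, Nonempty (I k) := fun k => h.nonempty_input (Classical.arbitrary P) k
    let d : ∀ k, I k × O k := fun k => Classical.arbitrary _
    obtain ⟨M, hM⟩ := exists_step_matrix h
    obtain ⟨M', hM'⟩ := exists_last_matrix h hN
    refine ⟨historyCircuit (amplitude V) d M M', isQCQC_historyCircuit h hN hM hM', 1, 1,
      by simp, by simp, fun A => ?_⟩
    rw [one_kronecker_one, one_mulVec]
    funext ⟨p, z⟩
    rw [link_equivalentChoiTensor h]
    exact Finset.sum_congr rfl fun g _ => by rw [processVector_historyCircuit hM hM']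

end Equivalence

end

theorem mainTheorem4 (N L : ℕ) (hN : 0 < N) (I O : Fin N → Type) (P F : Type)
    [∀ k, Fintype (I k)] [∀ k, Fintype (O k)] [Fintype P] [Fintype F]
    [∀ k, DecidableEq (I k)] [∀ k, DecidableEq (O k)] [DecidableEq P] [DecidableEq F]
    [∀ k, Nonempty (O k)] (Φ : ProcessBox N L I O P F) :
    (∃ (E : Type) (_ : Fintype E)
      (V : Matrix (WireBasis L I F × E) (WireBasis L O P) ℂ), Φ.IsPurification V) ∧
    ∀ (E : Type) [Fintype E] [DecidableEq E]
      (V : Matrix (WireBasis L I F × E) (WireBasis L O P) ℂ), Φ.IsPurification V →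
      ∃ Q : ControlledCircuit N I O P (F × E), Q.IsQCQC ∧ OperationallyEquivalent Q V := by
  refine ⟨?_, fun E _ _ V hV => hV.exists_circuit hN⟩
  classical
  obtain ⟨E, hE, V, h1, h2⟩ := Φ.map_cptp.exists_dilation
  refine ⟨E, hE, V, ?_, fun ρ y y' => ?_⟩
  · convert h1
  · convert h2 ρ y y'
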